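/- Let $n\ge 0$ and let $0=X_0,X_1,\dots,X_n$ be an $n$-step equilateral isotropic random walk in the plane $\mathbb R^2$, that is, the steps $X_1-X_0,\dots,X_n-X_{n-1}$ are independent and each is uniformly distributed on the unit circle. Let $K_n$ be the number of self-intersections of the walk: the number of pairs $(k,l)$ with $1\le k<l\le n$ and $l-k\ge 2$ such that the segments $[X_{k-1},X_k]$ and $[X_{l-1},X_l]$ have a common point that is interior to each of them. Then $$\operatorname{Var}[K_n]=O(n^2\log n).$$ Hence $K_n$ concentrates around its mean: more precisely, there is an absolute constant $C$ such that for all $n\ge 2$ $$\operatorname{Var}[K_n]\le C\,n^2\log n \qquad\text{and}\qquad \Pr\Big[\,\big|K_n-\mathrm{E}[K_n]\big|>n(\log n)^{2/3}\Big]\le \frac{C}{(\log n)^{1/3}},$$ and for every $\varepsilon>0$ $$\Pr\Big[\,\big|K_n-\mathrm{E}[K_n]\big|>\varepsilon\,\mathrm{E}[K_n]\Big]\to 0\qquad(n\to\infty).$$ -/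

import Mathlib

open MeasureTheory ProbabilityTheory

universe u

/-- The uniform distribution on the unit circle of the Euclidean plane `ℂ = ℝ²`: the law of
`exp (i θ)` for an angle `θ` that is uniformly distributed on `(0, 2π]`. -/
noncomputable def uniformUnitCircle : Measure ℂ :=
  (ProbabilityTheory.cond (volume : Measure ℝ) (Set.Ioc 0 (2 * Real.pi))).map
    (fun θ : ℝ => Complex.exp (θ * Complex.I))

/-- `X 0, X 1, …, X n` is an `n`-step equilateral isotropic random walk in the plane: it starts at
the origin, and its steps `X (k + 1) - X k` are independent and each uniformly distributed on the
unit circle. -/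
structure IsEquilateralIsotropicWalk {Ω : Type u} [MeasurableSpace Ω] (P : Measure Ω) {n : ℕ}
    (X : Fin (n + 1) → Ω → ℂ) : Prop where
  start : ∀ᵐ ω ∂P, X 0 ω = 0
  indep : iIndepFun (fun (k : Fin n) (ω : Ω) => X k.succ ω - X k.castSucc ω) P
  law : ∀ k : Fin n, HasLaw (fun ω : Ω => X k.succ ω - X k.castSucc ω) uniformUnitCircle P

/-- The number of self-intersections of the polygonal path with vertices `x 0, …, x n`: the number
of pairs of non-adjacent segments `[x i, x (i + 1)]`, `[x j, x (j + 1)]` with `i + 2 ≤ j` that meet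
in a point interior to each of the two segments. -/
noncomputable def numSelfIntersections {n : ℕ} (x : Fin (n + 1) → ℂ) : ℕ :=
  Set.ncard {p : Fin n × Fin n | (p.1 : ℕ) + 2 ≤ (p.2 : ℕ) ∧
    (openSegment ℝ (x p.1.castSucc) (x p.1.succ) ∩
      openSegment ℝ (x p.2.castSucc) (x p.2.succ)).Nonempty}

/-- The random variable `K_n`: the number of self-intersections of the random path `X`. -/
noncomputable def selfIntersectionCount {Ω : Type u} {n : ℕ} (X : Fin (n + 1) → Ω → ℂ)
    (ω : Ω) : ℝ :=
  (numSelfIntersections (fun k => X k ω) : ℝ)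

open scoped RealInnerProductSpace

/-! Everything is computed on the space of steps, where $K_n$ is a sum of crossing indicators over
pairs $p=(k,l)$ of non-adjacent steps, and the deviation bounds follow from Chebyshev.

Steps $k$ and $l$ can cross only if the sum of the steps strictly between them, the gap sum, has
norm at most $2$. A Gaussian bound for the characteristic function near $0$ shows that a sum of $m$
steps hits a given disc of radius $2$ with probability $O(1/(m+1))$
(`measureReal_closedBall_map_sum_le`).

The variance is the sum of all covariances. These vanish for pairs spanning disjoint ranges of
steps. Otherwise let $q$ be the pair with the shorter gap and let $d$ be the maximum-norm distance
of $p$ and $q$. The longer gap contains about $d$ consecutive steps outside the shorter one, and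
conditioning on the other steps bounds the covariance by $O\big(1/((q_2-q_1)(d+1))\big)$
(`measureReal_nearReturn_inter_le_pairDist`). Only $O(d)$ pairs lie at distance exactly $d\ge 1$
from $q$, so summing over $p$ gives $O(n)$; summing $1/(q_2-q_1)$ over $q$ gives $O(n\log n)$.

For concentration relative to the mean, $\mathrm E[K_n]\ge c\,n\log n$ is needed. An even gap sum is
a difference of two i.i.d. sums, which a pigeonhole argument brings within $1/2$ of each other with
probability of order $1/m$; given this, the two end steps cross with probability bounded below
(`le_measureReal_crossing`). -/

/-! ### The uniform law on the circle: rotation invariance and characteristic function -/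

theorem measurable_circleParam : Measurable (fun θ : ℝ => Complex.exp (θ * Complex.I)) := by
  fun_prop

instance instIsProbabilityMeasureUniformUnitCircle : IsProbabilityMeasure uniformUnitCircle := by
  have : IsProbabilityMeasure
      (ProbabilityTheory.cond (volume : Measure ℝ) (Set.Ioc 0 (2 * Real.pi))) :=
    cond_isProbabilityMeasure_of_finite (by simp [Real.pi_pos])
      (by rw [Real.volume_Ioc]; exact ENNReal.ofReal_ne_top)
  exact Measure.isProbabilityMeasure_map measurable_circleParam.aemeasurable

theorem integral_uniformUnitCircle {E : Type*} [NormedAddCommGroup E] [NormedSpace ℝ E]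
    {f : ℂ → E} (hf : StronglyMeasurable f) :
    ∫ z, f z ∂uniformUnitCircle =
      (2 * Real.pi)⁻¹ • ∫ θ in (0 : ℝ)..(2 * Real.pi), f (Complex.exp (θ * Complex.I)) := by
  rw [uniformUnitCircle, integral_map measurable_circleParam.aemeasurable
    hf.aestronglyMeasurable, ProbabilityTheory.cond, integral_smul_measure,
    intervalIntegral.integral_of_le (by positivity)]
  congr 1
  simp [Real.pi_pos.le]

theorem real_uniformUnitCircle {B : Set ℂ} (hB : MeasurableSet B) :
    uniformUnitCircle.real B = (2 * Real.pi)⁻¹ *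
      ∫ θ in (0 : ℝ)..(2 * Real.pi), B.indicator (1 : ℂ → ℝ) (Complex.exp (θ * Complex.I)) := by
  rw [← integral_indicator_one hB, integral_uniformUnitCircle
    (stronglyMeasurable_one.indicator hB), smul_eq_mul]

theorem ae_norm_eq_one_uniformUnitCircle : ∀ᵐ z ∂uniformUnitCircle, ‖z‖ = 1 := by
  rw [uniformUnitCircle, ae_map_iff measurable_circleParam.aemeasurable
    (measurableSet_eq_fun measurable_norm measurable_const)]
  exact Filter.Eventually.of_forall fun θ => Complex.norm_exp_ofReal_mul_I θ

/-- Rotations preserve the uniform distribution on the circle. -/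
theorem measurePreserving_mul_uniformUnitCircle {w : ℂ} (hw : ‖w‖ = 1) :
    MeasurePreserving (fun z => w * z) uniformUnitCircle uniformUnitCircle := by
  refine ⟨by fun_prop, ?_⟩
  obtain ⟨φ, rfl⟩ : ∃ φ : ℝ, w = Complex.exp (φ * Complex.I) := by
    refine ⟨w.arg, ?_⟩
    have := Complex.norm_mul_exp_arg_mul_I w
    rw [hw] at this
    simpa using this.symm
  have hm : Measurable (fun z : ℂ => Complex.exp (φ * Complex.I) * z) := by fun_prop
  have := Measure.isProbabilityMeasure_map (μ := uniformUnitCircle) hm.aemeasurable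
  ext B hB
  rw [← measureReal_eq_measureReal_iff, map_measureReal_apply hm hB,
    real_uniformUnitCircle (hm hB), real_uniformUnitCircle hB]
  congr 1
  set g : ℝ → ℝ := fun θ => B.indicator (1 : ℂ → ℝ) (Complex.exp (θ * Complex.I)) with hg
  have hper : Function.Periodic g (2 * Real.pi) := by
    intro θ
    simp only [hg]
    congr 1
    push_cast
    rw [add_mul, Complex.exp_add, Complex.exp_two_pi_mul_I, mul_one]
  have h1 : ∀ θ : ℝ, ((fun z : ℂ => Complex.exp (φ * Complex.I) * z) ⁻¹' B).indicator
      (1 : ℂ → ℝ) (Complex.exp (θ * Complex.I)) = g (θ + φ) := by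
    intro θ
    have : Complex.exp ((θ + φ : ℝ) * Complex.I) =
        Complex.exp (φ * Complex.I) * Complex.exp (θ * Complex.I) := by
      rw [← Complex.exp_add]
      push_cast
      ring_nf
    simp only [hg, this]
    rfl
  simp_rw [h1]
  rw [intervalIntegral.integral_comp_add_right g φ]
  have := hper.intervalIntegral_add_eq φ 0
  rw [zero_add] at this ⊢
  rw [← this, add_comm]

theorem uniformUnitCircle_singleton (w : ℂ) : uniformUnitCircle {w} = 0 := by
  rw [uniformUnitCircle, Measure.map_apply measurable_circleParam (measurableSet_singleton w),
    ProbabilityTheory.cond, Measure.smul_apply,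
    Measure.restrict_apply (measurable_circleParam (measurableSet_singleton w))]
  have : ((fun θ : ℝ => Complex.exp (θ * Complex.I)) ⁻¹' {w} ∩
      Set.Ioc 0 (2 * Real.pi)).Subsingleton := by
    rintro x ⟨hx, hx'⟩ y ⟨hy, hy'⟩
    simp only [Set.mem_preimage, Set.mem_singleton_iff] at hx hy
    rw [← hy, Complex.exp_eq_exp_iff_exists_int] at hx
    obtain ⟨m, hm⟩ := hx
    have h2 : x = y + m * (2 * Real.pi) := by
      have := congrArg Complex.im hm
      simpa using this
    have hp := Real.pi_pos
    have h3 : m < 1 := by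
      by_contra h
      push Not at h
      have : (1 : ℝ) ≤ m := by exact_mod_cast h
      nlinarith [hx'.2, hy'.1]
    have h4 : -1 < m := by
      by_contra h
      push Not at h
      have : (m : ℝ) ≤ -1 := by exact_mod_cast h
      nlinarith [hx'.1, hy'.2]
    have : m = 0 := by omega
    simpa [this] using h2
  rw [this.measure_zero]
  simp

theorem integral_comp_mul_uniformUnitCircle {E : Type*} [NormedAddCommGroup E] [NormedSpace ℝ E]
    {w : ℂ} (hw : ‖w‖ = 1) {f : ℂ → E} (hf : StronglyMeasurable f) :
    ∫ z, f (w * z) ∂uniformUnitCircle = ∫ z, f z ∂uniformUnitCircle := by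
  rw [← integral_map (measurePreserving_mul_uniformUnitCircle hw).measurable.aemeasurable
    hf.aestronglyMeasurable, (measurePreserving_mul_uniformUnitCircle hw).map_eq]

theorem integrable_uniformUnitCircle_of_bound {f : ℂ → ℝ} (hf : Measurable f) {C : ℝ}
    (hC : ∀ z : ℂ, ‖z‖ = 1 → |f z| ≤ C) : Integrable f uniformUnitCircle :=
  Integrable.of_bound hf.aestronglyMeasurable C
    (ae_norm_eq_one_uniformUnitCircle.mono fun z hz => hC z hz)

/-- On the circle a quarter turn replaces the integrand by `‖t‖ ^ 2` minus itself, and rotation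
invariance equates the two integrals. -/
theorem integral_inner_sq_uniformUnitCircle (t : ℂ) :
    ∫ z, ⟪z, t⟫ ^ 2 ∂uniformUnitCircle = ‖t‖ ^ 2 / 2 := by
  have hb : ∀ t z : ℂ, ‖z‖ = 1 → |⟪z, t⟫ ^ 2| ≤ ‖t‖ ^ 2 := by
    intro t z hz
    rw [abs_pow]
    have := abs_real_inner_le_norm z t
    rw [hz, one_mul] at this
    gcongr
  have hrot := integral_comp_mul_uniformUnitCircle (w := Complex.I) (by simp)
    (f := fun z => ⟪z, t⟫ ^ 2) (Measurable.stronglyMeasurable (by fun_prop))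
  have hi : ∀ s : ℂ, Integrable (fun z => ⟪z, s⟫ ^ 2) uniformUnitCircle := fun s =>
    integrable_uniformUnitCircle_of_bound (by fun_prop) (hb s)
  have hI : ∀ z : ℂ, ⟪Complex.I * z, t⟫ ^ 2 = ‖z‖ ^ 2 * ‖t‖ ^ 2 - ⟪z, t⟫ ^ 2 := by
    intro z
    simp only [Complex.inner, Complex.sq_norm, Complex.normSq_apply]
    simp
    ring
  have hsum : ∫ z, ⟪Complex.I * z, t⟫ ^ 2 ∂uniformUnitCircle =
      ‖t‖ ^ 2 - ∫ z, ⟪z, t⟫ ^ 2 ∂uniformUnitCircle := by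
    have : ∫ z, ⟪Complex.I * z, t⟫ ^ 2 ∂uniformUnitCircle =
        ∫ z, (‖t‖ ^ 2 - ⟪z, t⟫ ^ 2) ∂uniformUnitCircle := by
      refine integral_congr_ae (ae_norm_eq_one_uniformUnitCircle.mono fun z hz => ?_)
      simp only [hI, hz]
      ring
    rw [this, integral_sub (integrable_const _) (hi t)]
    simp
  linarith

/-- Invariance under `z ↦ -z` makes the characteristic function equal to its conjugate, so only the
real part survives. -/
theorem charFun_uniformUnitCircle_eq_integral_cos (t : ℂ) :
    charFun uniformUnitCircle t = ((∫ z, Real.cos ⟪z, t⟫ ∂uniformUnitCircle : ℝ) : ℂ) := by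
  have hneg : charFun uniformUnitCircle (-t) = charFun uniformUnitCircle t := by
    rw [charFun_apply, charFun_apply]
    have := integral_comp_mul_uniformUnitCircle (w := -1) (by simp)
      (f := fun z => Complex.exp (⟪z, t⟫ * Complex.I)) (Measurable.stronglyMeasurable (by fun_prop))
    rw [← this]
    simp
  rw [charFun_neg] at hneg
  have hre := Complex.conj_eq_iff_real.1 hneg
  obtain ⟨r, hr⟩ := hre
  rw [hr]
  congr 1
  have h1 : r = (charFun uniformUnitCircle t).re := by rw [hr]; simp
  rw [h1, charFun_apply]
  have hint : Integrable (fun z : ℂ => Complex.exp (⟪z, t⟫ * Complex.I)) uniformUnitCircle :=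
    Integrable.of_bound (Measurable.aestronglyMeasurable (by fun_prop)) 1
      (Filter.Eventually.of_forall fun z => by rw [Complex.norm_exp_ofReal_mul_I])
  have := integral_re hint
  simp only [RCLike.re_to_complex] at this
  rw [← this]
  congr 1
  ext z
  rw [Complex.exp_ofReal_mul_I_re]

/-- Averaging `cos x ≤ 1 - 2 x² / π²` over the circle gives `1 - ‖t‖² / π²`. The restriction on `t`
keeps the cosine nonnegative, so the norm can be dropped. -/
theorem norm_charFun_uniformUnitCircle_le {t : ℂ} (ht : ‖t‖ ≤ 1) :
    ‖charFun uniformUnitCircle t‖ ≤ Real.exp (-(‖t‖ ^ 2 / Real.pi ^ 2)) := by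
  have hin : ∀ z : ℂ, ‖z‖ = 1 → |⟪z, t⟫| ≤ 1 := by
    intro z hz
    have := abs_real_inner_le_norm z t
    rw [hz, one_mul] at this
    linarith
  have hpi := Real.pi_gt_three
  rw [charFun_uniformUnitCircle_eq_integral_cos, Complex.norm_real, Real.norm_eq_abs,
    abs_of_nonneg]
  · calc ∫ z, Real.cos ⟪z, t⟫ ∂uniformUnitCircle
        ≤ ∫ z, (1 - 2 / Real.pi ^ 2 * ⟪z, t⟫ ^ 2) ∂uniformUnitCircle := by
          refine integral_mono_ae ?_ ?_ ?_
          · exact integrable_uniformUnitCircle_of_bound (C := 1) (by fun_prop)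
              fun z _ => Real.abs_cos_le_one _
          · refine (integrable_const _).sub (Integrable.const_mul ?_ _)
            refine integrable_uniformUnitCircle_of_bound (C := 1) (by fun_prop) fun z hz => ?_
            rw [abs_pow]
            exact pow_le_one₀ (abs_nonneg _) (hin z hz)
          · refine ae_norm_eq_one_uniformUnitCircle.mono fun z hz => ?_
            exact Real.cos_le_one_sub_mul_cos_sq ((hin z hz).trans (by linarith))
      _ = 1 - ‖t‖ ^ 2 / Real.pi ^ 2 := by
          rw [integral_sub (integrable_const _), integral_const_mul,
            integral_inner_sq_uniformUnitCircle]
          · simp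
          · refine Integrable.const_mul ?_ _
            refine integrable_uniformUnitCircle_of_bound (C := 1) (by fun_prop) fun z hz => ?_
            rw [abs_pow]
            exact pow_le_one₀ (abs_nonneg _) (hin z hz)
      _ ≤ _ := by
          have := Real.add_one_le_exp (-(‖t‖ ^ 2 / Real.pi ^ 2))
          linarith
  · refine integral_nonneg_of_ae (ae_norm_eq_one_uniformUnitCircle.mono fun z hz => ?_)
    have := abs_le.1 (hin z hz)
    exact Real.cos_nonneg_of_neg_pi_div_two_le_of_le (by linarith) (by linarith)

/-! ### From characteristic functions to masses of discs -/

/-- The integral of a characteristic function against a probability measure, with the roles of the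
two measures exchanged. -/
theorem norm_integral_charFun_sub_le (κ ν : Measure ℂ) [IsProbabilityMeasure κ]
    [IsProbabilityMeasure ν] (x : ℂ) :
    ‖∫ y, charFun κ (y - x) ∂ν‖ ≤ ∫ t, ‖charFun ν t‖ ∂κ := by
  have h : ∫ y, charFun κ (y - x) ∂ν =
      ∫ t, Complex.exp (-⟪t, x⟫ * Complex.I) * charFun ν t ∂κ := by
    simp_rw [charFun_apply]
    rw [integral_integral_swap]
    · congr 1
      ext t
      rw [← integral_const_mul]
      congr 1
      ext y
      rw [← Complex.exp_add, inner_sub_right, real_inner_comm y t]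
      push_cast
      ring_nf
    · refine Integrable.of_bound (Measurable.aestronglyMeasurable (by fun_prop)) 1
        (Filter.Eventually.of_forall fun z => ?_)
      simp only [Function.uncurry]
      rw [Complex.norm_exp_ofReal_mul_I]
  rw [h]
  refine (norm_integral_le_integral_norm _).trans (le_of_eq ?_)
  congr 1
  ext t
  rw [norm_mul, ← Complex.ofReal_neg, Complex.norm_exp_ofReal_mul_I, one_mul]

/-- The uniform distribution on the closed disc of radius `1 / 2`. -/
noncomputable def uniformDisc : Measure ℂ :=
  ProbabilityTheory.cond volume (Metric.closedBall (0 : ℂ) (1 / 2))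

instance instIsProbabilityMeasureUniformDisc : IsProbabilityMeasure uniformDisc :=
  cond_isProbabilityMeasure_of_finite
    (Metric.measure_closedBall_pos _ _ (by norm_num)).ne'
    (isCompact_closedBall _ _).measure_lt_top.ne

theorem ae_norm_le_uniformDisc : ∀ᵐ s ∂uniformDisc, ‖s‖ ≤ 1 / 2 := by
  rw [uniformDisc, ProbabilityTheory.cond]
  refine Measure.ae_smul_measure ?_ _
  filter_upwards [ae_restrict_mem Metric.isClosed_closedBall.measurableSet] with s hs
  simpa using hs

theorem integral_uniformDisc_le {f : ℂ → ℝ} (hf : Integrable f) (h0 : ∀ z, 0 ≤ f z) :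
    ∫ s, f s ∂uniformDisc ≤ 4 / Real.pi * ∫ s, f s := by
  rw [uniformDisc, ProbabilityTheory.cond, integral_smul_measure, smul_eq_mul]
  have hv : ((volume (Metric.closedBall (0 : ℂ) (1 / 2)))⁻¹).toReal = 4 / Real.pi := by
    rw [Complex.volume_closedBall]
    simp
    norm_num
    field_simp
  rw [hv]
  have := Real.pi_pos
  refine mul_le_mul_of_nonneg_left ?_ (by positivity)
  exact integral_mono_measure Measure.restrict_le_self (Filter.Eventually.of_forall h0) hf

theorem half_le_norm_charFun_uniformDisc {z : ℂ} (hz : ‖z‖ ≤ 2) :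
    1 / 2 ≤ ‖charFun uniformDisc z‖ := by
  refine le_trans ?_ (Complex.re_le_norm _)
  have hint : Integrable (fun s : ℂ => Complex.exp (⟪s, z⟫ * Complex.I)) uniformDisc :=
    Integrable.of_bound (Measurable.aestronglyMeasurable (by fun_prop)) 1
      (Filter.Eventually.of_forall fun z => by rw [Complex.norm_exp_ofReal_mul_I])
  have h := integral_re hint
  simp only [RCLike.re_to_complex, Complex.exp_ofReal_mul_I_re] at h
  rw [charFun_apply, ← h]
  have h2 : ∫ _, (1 / 2 : ℝ) ∂uniformDisc = 1 / 2 := by simp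
  rw [← h2]
  refine integral_mono_ae (integrable_const _) ?_ ?_
  · exact Integrable.of_bound (Measurable.aestronglyMeasurable (by fun_prop)) 1
      (Filter.Eventually.of_forall fun z => Real.abs_cos_le_one _)
  · refine ae_norm_le_uniformDisc.mono fun s hs => ?_
    have h3 : |⟪s, z⟫| ≤ 1 := by
      refine (abs_real_inner_le_norm s z).trans ?_
      nlinarith [norm_nonneg s, norm_nonneg z]
    have h4 := Real.one_sub_sq_div_two_le_cos (x := ⟪s, z⟫)
    have h5 : ⟪s, z⟫ ^ 2 ≤ 1 := by
      rw [← sq_abs]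
      exact pow_le_one₀ (abs_nonneg _) h3
    simp only
    linarith

/-- A Gaussian bound of the characteristic function near `0` bounds the mass of all discs of
radius `2`. -/
theorem measureReal_closedBall_le_of_charFun_le (ν : Measure ℂ) [IsProbabilityMeasure ν] {b : ℝ}
    (hb : 0 < b) (hν : ∀ t : ℂ, ‖t‖ ≤ 1 → ‖charFun ν t‖ ≤ Real.exp (-b * ‖t‖ ^ 2)) (x : ℂ) :
    ν.real (Metric.closedBall x 2) ≤ 16 / b := by
  -- The law of a difference of two independent points of the disc: it lives on the unit disc, where
  -- `hν` applies, and its characteristic function is a squared norm, at least `1 / 4` on the disc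
  -- of radius `2`.
  set κ : Measure ℂ := (uniformDisc.prod uniformDisc).map (fun p => p.1 - p.2) with hκ
  have hm : Measurable (fun p : ℂ × ℂ => p.1 - p.2) := by fun_prop
  have : IsProbabilityMeasure κ := Measure.isProbabilityMeasure_map hm.aemeasurable
  have hchar : ∀ z, charFun κ z = ((‖charFun uniformDisc z‖ ^ 2 : ℝ) : ℂ) := by
    intro z
    rw [charFun_apply, hκ, integral_map hm.aemeasurable
      (Measurable.aestronglyMeasurable (by fun_prop))]
    have h1 : ∀ p : ℂ × ℂ, Complex.exp (⟪p.1 - p.2, z⟫ * Complex.I) =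
        Complex.exp (⟪p.1, z⟫ * Complex.I) * Complex.exp (⟪p.2, -z⟫ * Complex.I) := by
      intro p
      rw [← Complex.exp_add, inner_sub_left, inner_neg_right]
      push_cast
      ring_nf
    simp_rw [h1]
    rw [integral_prod_mul (fun s : ℂ => Complex.exp (⟪s, z⟫ * Complex.I))
      (fun s : ℂ => Complex.exp (⟪s, -z⟫ * Complex.I)), ← charFun_apply, ← charFun_apply,
      charFun_neg, Complex.mul_conj, Complex.normSq_eq_norm_sq]
  have hlow : ν.real (Metric.closedBall x 2) * (1 / 4) ≤
      ∫ y, ‖charFun uniformDisc (y - x)‖ ^ 2 ∂ν := by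
    rw [← integral_indicator_one Metric.isClosed_closedBall.measurableSet, ← integral_mul_const]
    refine integral_mono_of_nonneg ?_ ?_ (Filter.Eventually.of_forall fun y => ?_)
    · exact Filter.Eventually.of_forall fun y => mul_nonneg
        (Set.indicator_nonneg (fun _ _ => zero_le_one) _) (by norm_num)
    · refine Integrable.of_bound (C := 1) (Measurable.aestronglyMeasurable ?_)
        (Filter.Eventually.of_forall fun y => ?_)
      · exact ((measurable_charFun.comp (measurable_id.sub_const x)).norm).pow_const 2
      · rw [norm_pow, norm_norm]
        exact pow_le_one₀ (norm_nonneg _) (norm_charFun_le_one _)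
    · by_cases hy : y ∈ Metric.closedBall x 2
      · simp only [hy, Set.indicator_of_mem, Pi.one_apply, one_mul]
        rw [Metric.mem_closedBall, dist_eq_norm] at hy
        have := half_le_norm_charFun_uniformDisc hy
        nlinarith
      · simp only [hy, not_false_eq_true, Set.indicator_of_notMem, zero_mul]
        positivity
  have heq : ∫ y, ‖charFun uniformDisc (y - x)‖ ^ 2 ∂ν ≤ ∫ t, ‖charFun ν t‖ ∂κ := by
    refine le_trans ?_ (norm_integral_charFun_sub_le κ ν x)
    simp_rw [hchar]
    rw [integral_complex_ofReal, Complex.norm_real]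
    exact le_abs_self _
  have hg : ∀ c : ℂ, Integrable (fun s : ℂ => Real.exp (-b * ‖s - c‖ ^ 2)) := fun c =>
    Integrable.comp_sub_right (f := fun s : ℂ => Real.exp (-b * ‖s‖ ^ 2))
      (by
        have := GaussianFourier.integrable_cexp_neg_mul_sq_norm_add (V := ℂ) (b := b)
          (by simpa using hb) 0 0
        refine this.re.congr (Filter.Eventually.of_forall fun s => ?_)
        simp only [RCLike.re_to_complex, inner_zero_left, Complex.ofReal_zero, mul_zero, add_zero]
        rw [← Complex.ofReal_pow, ← Complex.ofReal_neg, ← Complex.ofReal_mul,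
          Complex.exp_ofReal_re]) c
  have hup : ∫ t, ‖charFun ν t‖ ∂κ ≤ 4 / b := by
    rw [hκ, integral_map hm.aemeasurable measurable_charFun.norm.aestronglyMeasurable]
    have hint : Integrable (fun p : ℂ × ℂ => ‖charFun ν (p.1 - p.2)‖)
        (uniformDisc.prod uniformDisc) := by
      refine Integrable.of_bound (C := 1) (Measurable.aestronglyMeasurable ?_)
        (Filter.Eventually.of_forall fun y => ?_)
      · exact (measurable_charFun.comp hm).norm
      · rw [norm_norm]
        exact norm_charFun_le_one _
    rw [integral_prod_symm _ hint]
    have hle : ∀ᵐ c ∂uniformDisc, ∫ s, ‖charFun ν (s - c)‖ ∂uniformDisc ≤ 4 / b := by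
      filter_upwards [ae_norm_le_uniformDisc] with c hc
      calc ∫ s, ‖charFun ν (s - c)‖ ∂uniformDisc
          ≤ ∫ s, Real.exp (-b * ‖s - c‖ ^ 2) ∂uniformDisc := by
            refine integral_mono_of_nonneg (Filter.Eventually.of_forall fun _ => norm_nonneg _)
              ?_ ?_
            · refine Integrable.of_bound (C := 1) (Measurable.aestronglyMeasurable (by fun_prop))
                (Filter.Eventually.of_forall fun y => ?_)
              rw [Real.norm_eq_abs, Real.abs_exp, Real.exp_le_one_iff]
              have := sq_nonneg ‖y - c‖
              nlinarith
            · filter_upwards [ae_norm_le_uniformDisc] with s hs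
              refine hν _ ((norm_sub_le _ _).trans (by linarith))
        _ ≤ 4 / Real.pi * ∫ s, Real.exp (-b * ‖s - c‖ ^ 2) :=
            integral_uniformDisc_le (hg c) fun _ => (Real.exp_pos _).le
        _ = 4 / b := by
            rw [integral_sub_right_eq_self (fun s : ℂ => Real.exp (-b * ‖s‖ ^ 2)) c,
              GaussianFourier.integral_rexp_neg_mul_sq_norm hb]
            have := Real.pi_pos
            simp
            field_simp
    calc ∫ c, ∫ s, ‖charFun ν (s - c)‖ ∂uniformDisc ∂uniformDisc
        ≤ ∫ _, 4 / b ∂uniformDisc :=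
          integral_mono_of_nonneg
            (Filter.Eventually.of_forall fun _ => integral_nonneg fun _ => norm_nonneg _)
            (integrable_const _) hle
      _ = 4 / b := by simp
  have : (16 : ℝ) / b = 4 * (4 / b) := by ring
  linarith

/-! ### Independent steps and the local limit upper bound -/

/-- The law of `n` independent uniformly distributed steps. -/
noncomputable def stepMeasure (n : ℕ) : Measure (Fin n → ℂ) :=
  Measure.pi fun _ => uniformUnitCircle

instance instIsProbabilityMeasureStepMeasure (n : ℕ) : IsProbabilityMeasure (stepMeasure n) := by
  unfold stepMeasure
  infer_instance

theorem iIndepFun_stepMeasure (n : ℕ) :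
    iIndepFun (fun (i : Fin n) (ξ : Fin n → ℂ) => ξ i) (stepMeasure n) :=
  iIndepFun_pi (X := fun _ => id) fun _ => aemeasurable_id

theorem map_eval_stepMeasure {n : ℕ} (i : Fin n) :
    (stepMeasure n).map (fun ξ => ξ i) = uniformUnitCircle :=
  (measurePreserving_eval (fun _ : Fin n => uniformUnitCircle) i).map_eq

/-- Functions of disjoint sets of steps are independent. -/
theorem indepFun_of_dependsOn {n : ℕ} {β γ : Type*} [MeasurableSpace β] [MeasurableSpace γ]
    {f : (Fin n → ℂ) → β} {g : (Fin n → ℂ) → γ} (hf : Measurable f) (hg : Measurable g)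
    {S T : Finset (Fin n)} (hST : Disjoint S T) (hfS : DependsOn f (S : Set (Fin n)))
    (hgT : DependsOn g (T : Set (Fin n))) : IndepFun f g (stepMeasure n) := by
  have hind := (iIndepFun_stepMeasure n).indepFun_finset S T hST (fun i => measurable_pi_apply i)
  -- Padding the coordinates in `U` by zero lets `f` and `g` factor through restrictions; the
  -- padding value is irrelevant by `DependsOn`.
  have hext : ∀ U : Finset (Fin n), Measurable
      (fun (w : U → ℂ) (i : Fin n) => if h : i ∈ U then w ⟨i, h⟩ else 0) := by
    intro U
    refine measurable_pi_lambda _ fun i => ?_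
    by_cases h : i ∈ U
    · simp only [h, dif_pos]
      fun_prop
    · simp only [h, dite_false]
      exact measurable_const
  have h := hind.comp (hf.comp (hext S)) (hg.comp (hext T))
  convert h using 1
  · ext ξ
    refine hfS fun i hi => ?_
    simp [Finset.mem_coe.1 hi]
  · ext ξ
    refine hgT fun i hi => ?_
    simp [Finset.mem_coe.1 hi]

theorem charFun_map_sum_stepMeasure {n : ℕ} (J : Finset (Fin n)) (t : ℂ) :
    charFun ((stepMeasure n).map (fun ξ => ∑ i ∈ J, ξ i)) t =
      charFun uniformUnitCircle t ^ J.card := by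
  have h := ((iIndepFun_stepMeasure n).restrict J).charFun_map_fun_finsetSum_eq_prod
    (fun i _ => (measurable_pi_apply i).aemeasurable)
  rw [h, Finset.prod_apply]
  simp_rw [map_eval_stepMeasure]
  simp

/-- The local limit upper bound. -/
theorem measureReal_closedBall_map_sum_le {n : ℕ} (J : Finset (Fin n)) (x : ℂ) :
    ((stepMeasure n).map (fun ξ => ∑ i ∈ J, ξ i)).real (Metric.closedBall x 2) ≤
      32 * Real.pi ^ 2 / (J.card + 1) := by
  have hm : Measurable (fun ξ : Fin n → ℂ => ∑ i ∈ J, ξ i) := by fun_prop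
  have : IsProbabilityMeasure ((stepMeasure n).map (fun ξ => ∑ i ∈ J, ξ i)) :=
    Measure.isProbabilityMeasure_map hm.aemeasurable
  have hpi := Real.pi_gt_three
  rcases Nat.eq_zero_or_pos J.card with h0 | hpos
  · refine measureReal_le_one.trans ?_
    rw [h0]
    norm_num
    nlinarith
  · have hJ : (1 : ℝ) ≤ J.card := by exact_mod_cast hpos
    have h := measureReal_closedBall_le_of_charFun_le
      ((stepMeasure n).map (fun ξ => ∑ i ∈ J, ξ i)) (b := J.card / Real.pi ^ 2) (by positivity)
      (fun t ht => ?_) x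
    · refine h.trans ?_
      rw [div_div_eq_mul_div, div_le_div_iff₀ (by positivity) (by positivity)]
      have : 0 < Real.pi ^ 2 := by positivity
      nlinarith
    · rw [charFun_map_sum_stepMeasure, norm_pow]
      refine (pow_le_pow_left₀ (norm_nonneg _) (norm_charFun_uniformUnitCircle_le ht) _).trans ?_
      rw [← Real.exp_nat_mul]
      refine Real.exp_le_exp.2 (le_of_eq ?_)
      ring

/-- Requiring a sum over a set `J` of steps to hit a disc that is determined by independent data
costs a factor of order `1 / (#J + 1)`. -/
theorem measureReal_inter_sum_near_le {n : ℕ} {β : Type*} [MeasurableSpace β]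
    {J T : Finset (Fin n)} (hJT : Disjoint J T) {W : (Fin n → ℂ) → β} (hW : Measurable W)
    (hWT : DependsOn W (T : Set (Fin n))) {g : β → ℂ} (hg : Measurable g) {D : Set β}
    (hD : MeasurableSet D) :
    (stepMeasure n).real {ξ | W ξ ∈ D ∧ ‖∑ i ∈ J, ξ i + g (W ξ)‖ ≤ 2} ≤
      32 * Real.pi ^ 2 / (J.card + 1) * (stepMeasure n).real {ξ | W ξ ∈ D} := by
  have hm : Measurable (fun ξ : Fin n → ℂ => ∑ i ∈ J, ξ i) := by fun_prop
  have hind : IndepFun W (fun ξ : Fin n → ℂ => ∑ i ∈ J, ξ i) (stepMeasure n) := by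
    refine indepFun_of_dependsOn hW hm hJT.symm hWT fun ξ η h => ?_
    exact Finset.sum_congr rfl fun i hi => h i hi
  have hmap := hind.map_prod_eq_prod_map_map hW.aemeasurable hm.aemeasurable
  have : IsProbabilityMeasure ((stepMeasure n).map (fun ξ => ∑ i ∈ J, ξ i)) :=
    Measure.isProbabilityMeasure_map hm.aemeasurable
  have : IsProbabilityMeasure ((stepMeasure n).map W) :=
    Measure.isProbabilityMeasure_map hW.aemeasurable
  set B : Set (β × ℂ) := {p | p.1 ∈ D ∧ ‖p.2 + g p.1‖ ≤ 2} with hB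
  have hBm : MeasurableSet B :=
    (measurable_fst hD).inter (measurableSet_le
      (measurable_snd.add (hg.comp measurable_fst)).norm measurable_const)
  have h1 : (stepMeasure n) {ξ | W ξ ∈ D ∧ ‖∑ i ∈ J, ξ i + g (W ξ)‖ ≤ 2} =
      ((stepMeasure n).map (fun ξ => (W ξ, ∑ i ∈ J, ξ i))) B := by
    rw [Measure.map_apply (hW.prodMk hm) hBm]
    rfl
  have h2 : (stepMeasure n) {ξ | W ξ ∈ D} = (stepMeasure n).map W D := by
    rw [Measure.map_apply hW hD]
    rfl
  have hc : (0 : ℝ) ≤ 32 * Real.pi ^ 2 / (J.card + 1) := by positivity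
  -- Fubini: for a fixed value `w` of `W` the sum over `J` must fall in the disc around `-g w`,
  -- whose mass is bounded uniformly in `w`.
  have key : (stepMeasure n) {ξ | W ξ ∈ D ∧ ‖∑ i ∈ J, ξ i + g (W ξ)‖ ≤ 2} ≤
      ENNReal.ofReal (32 * Real.pi ^ 2 / (J.card + 1)) * (stepMeasure n) {ξ | W ξ ∈ D} := by
    rw [h1, hmap, Measure.prod_apply hBm, h2, ← setLIntegral_const, ← lintegral_indicator hD]
    refine lintegral_mono fun w => ?_
    by_cases hw : w ∈ D
    · rw [Set.indicator_of_mem hw]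
      refine le_trans (measure_mono (t := Metric.closedBall (-g w) 2) ?_) ?_
      · rintro z ⟨-, hz⟩
        rw [Metric.mem_closedBall, dist_eq_norm, sub_neg_eq_add]
        exact hz
      · rw [← ENNReal.ofReal_toReal (measure_ne_top _ (Metric.closedBall (-g w) 2))]
        exact ENNReal.ofReal_le_ofReal (measureReal_closedBall_map_sum_le J _)
    · have : Prod.mk w ⁻¹' B = ∅ := by
        ext z
        simp [hB, hw]
      rw [this, measure_empty]
      exact zero_le
  have h3 := ENNReal.toReal_mono (ENNReal.mul_ne_top ENNReal.ofReal_ne_top (measure_ne_top _ _)) key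
  rwa [ENNReal.toReal_mul, ENNReal.toReal_ofReal hc] at h3

/-! ### Crossings and near returns -/

/-- The sum of the steps strictly between the steps `k` and `l`. -/
noncomputable def gapSum {n : ℕ} (k l : Fin n) (ξ : Fin n → ℂ) : ℂ :=
  ∑ i ∈ Finset.Ioo k l, ξ i

/-- The event that the steps `k` and `l` of the path with steps `ξ` cross. -/
def crossing {n : ℕ} (k l : Fin n) : Set (Fin n → ℂ) :=
  {ξ | ∃ a ∈ Set.Ioo (0 : ℝ) 1, ∃ b ∈ Set.Ioo (0 : ℝ) 1,
    gapSum k l ξ + a * ξ k + b * ξ l = 0}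

/-- The event that the sum of the steps between `k` and `l` has norm at most `2`. -/
def nearReturn {n : ℕ} (k l : Fin n) : Set (Fin n → ℂ) :=
  {ξ | ‖gapSum k l ξ‖ ≤ 2}

theorem measurable_gapSum {n : ℕ} (k l : Fin n) : Measurable (gapSum k l) := by
  unfold gapSum
  fun_prop

/-- The triples `(s, u, v)` with `s + a u + b v = 0` for some `a, b ∈ (0, 1)`. -/
def crossingTriples : Set (ℂ × ℂ × ℂ) :=
  {p | ∃ a ∈ Set.Ioo (0 : ℝ) 1, ∃ b ∈ Set.Ioo (0 : ℝ) 1, p.1 + a * p.2.1 + b * p.2.2 = 0}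

/-- The existential quantifiers range over uncountable sets, so the set is exhibited as a continuous
image of a σ-compact space. -/
theorem measurableSet_crossingTriples : MeasurableSet crossingTriples := by
  have h : crossingTriples = Set.range
      (fun q : (Set.Ioo (0 : ℝ) 1 × Set.Ioo (0 : ℝ) 1) × (ℂ × ℂ) =>
        ((-((q.1.1 : ℝ) * q.2.1 + (q.1.2 : ℝ) * q.2.2) : ℂ), q.2)) := by
    ext ⟨s, u, v⟩
    simp only [crossingTriples, Set.mem_ofPred_eq, Set.mem_range]
    constructor
    · rintro ⟨a, ha, b, hb, h⟩
      refine ⟨((⟨a, ha⟩, ⟨b, hb⟩), (u, v)), ?_⟩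
      simp only [Prod.mk.injEq, and_true]
      linear_combination -h
    · rintro ⟨⟨⟨⟨a, ha⟩, ⟨b, hb⟩⟩, ⟨u', v'⟩⟩, h⟩
      simp only [Prod.mk.injEq] at h
      obtain ⟨h1, rfl, rfl⟩ := h
      exact ⟨a, ha, b, hb, by linear_combination -h1⟩
  have hs : IsSigmaCompact crossingTriples := by
    have : LocallyCompactSpace (Set.Ioo (0 : ℝ) 1) := isOpen_Ioo.locallyCompactSpace
    rw [h]
    exact isSigmaCompact_range (by fun_prop)
  obtain ⟨K, hK, hU⟩ := hs
  rw [← hU]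
  exact MeasurableSet.iUnion fun i => (hK i).measurableSet

theorem measurableSet_crossing {n : ℕ} (k l : Fin n) : MeasurableSet (crossing k l) :=
  ((measurable_gapSum k l).prodMk ((measurable_pi_apply k).prodMk (measurable_pi_apply l)))
    measurableSet_crossingTriples

theorem ae_norm_eq_one_stepMeasure {n : ℕ} (i : Fin n) : ∀ᵐ ξ ∂stepMeasure n, ‖ξ i‖ = 1 := by
  have h := ae_norm_eq_one_uniformUnitCircle
  rw [← map_eval_stepMeasure i] at h
  exact ae_of_ae_map (measurable_pi_apply i).aemeasurable h

theorem crossing_ae_le_nearReturn {n : ℕ} (k l : Fin n) :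
    crossing k l ≤ᵐ[stepMeasure n] nearReturn k l := by
  filter_upwards [ae_norm_eq_one_stepMeasure k, ae_norm_eq_one_stepMeasure l] with ξ hk hl h
  obtain ⟨a, ha, b, hb, h⟩ := h
  change ‖gapSum k l ξ‖ ≤ 2
  have h1 : gapSum k l ξ = -(a * ξ k + b * ξ l) := by linear_combination h
  rw [h1, norm_neg]
  refine (norm_add_le _ _).trans ?_
  rw [norm_mul, norm_mul, hk, hl, Complex.norm_real, Complex.norm_real, Real.norm_eq_abs,
    Real.norm_eq_abs, abs_of_pos ha.1, abs_of_pos hb.1]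
  linarith [ha.2, hb.2]

theorem measureReal_nearReturn_le {n : ℕ} (k l : Fin n) :
    (stepMeasure n).real (nearReturn k l) ≤ 32 * Real.pi ^ 2 / ((Finset.Ioo k l).card + 1) := by
  refine le_trans (le_of_eq ?_) (measureReal_closedBall_map_sum_le (Finset.Ioo k l) 0)
  rw [map_measureReal_apply (by fun_prop) Metric.isClosed_closedBall.measurableSet]
  congr 1
  ext ξ
  simp [nearReturn, gapSum]

/-- `J` is a part of the first gap untouched by the second. Given all other steps of both gaps, the
sum over `J` must hit a prescribed disc, which yields the first factor; the second gap alone yields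
the other. -/
theorem measureReal_nearReturn_inter_le {n : ℕ} {k l k' l' : Fin n} {J : Finset (Fin n)}
    (hJ : J ⊆ Finset.Ioo k l) (hJ' : Disjoint J (Finset.Ioo k' l')) :
    (stepMeasure n).real (nearReturn k l ∩ nearReturn k' l') ≤
      32 * Real.pi ^ 2 / (J.card + 1) * (32 * Real.pi ^ 2 / ((Finset.Ioo k' l').card + 1)) := by
  set W : (Fin n → ℂ) → ℂ × ℂ := fun ξ => (gapSum k' l' ξ, ∑ i ∈ Finset.Ioo k l \ J, ξ i) with hW
  have hWm : Measurable W := (measurable_gapSum k' l').prodMk (by fun_prop)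
  have h := measureReal_inter_sum_near_le (J := J) (T := Finset.Ioo k' l' ∪ (Finset.Ioo k l \ J))
    (Finset.disjoint_union_right.2 ⟨hJ', Finset.disjoint_sdiff⟩) hWm
    (fun ξ η hξ => by
      simp only [hW, gapSum]
      congr 1
      · exact Finset.sum_congr rfl fun i hi =>
          hξ i (Finset.mem_coe.2 (Finset.mem_union_left _ hi))
      · exact Finset.sum_congr rfl fun i hi =>
          hξ i (Finset.mem_coe.2 (Finset.mem_union_right _ hi)))
    (g := Prod.snd) measurable_snd (D := {p | ‖p.1‖ ≤ 2})
    (measurableSet_le measurable_fst.norm measurable_const)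
  have hset : nearReturn k l ∩ nearReturn k' l' =
      {ξ | W ξ ∈ {p : ℂ × ℂ | ‖p.1‖ ≤ 2} ∧ ‖∑ i ∈ J, ξ i + (W ξ).2‖ ≤ 2} := by
    ext ξ
    have : gapSum k l ξ = ∑ i ∈ J, ξ i + ∑ i ∈ Finset.Ioo k l \ J, ξ i := by
      rw [gapSum, add_comm, Finset.sum_sdiff hJ]
    simp only [nearReturn, Set.mem_inter_iff, Set.mem_ofPred_eq, hW, this]
    tauto
  rw [hset]
  refine h.trans ?_
  gcongr
  exact measureReal_nearReturn_le k' l'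

/-! ### Joint near returns and the sums over pairs -/

theorem cast_sub_sub_one_add_one {k l : ℕ} (h : k < l) :
    ((l - k - 1 : ℕ) : ℝ) + 1 = (l : ℝ) - k := by
  have : (l : ℝ) = ((l - k - 1 : ℕ) : ℝ) + 1 + k := by
    exact_mod_cast (by omega : l = (l - k - 1) + 1 + k)
  linarith

/-- The distance of two pairs of indices in the maximum norm. -/
def pairDist {n : ℕ} (p q : Fin n × Fin n) : ℕ :=
  max ((p.1 : ℤ) - q.1).natAbs ((p.2 : ℤ) - q.2).natAbs

theorem measureReal_nearReturn_inter_le_pairDist {n : ℕ} {p q : Fin n × Fin n}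
    (hq : q.1 < q.2) (hpq : (q.2 : ℤ) - q.1 ≤ p.2 - p.1)
    (h1 : p.1 ≤ q.2) (h2 : q.1 ≤ p.2) :
    (stepMeasure n).real (nearReturn p.1 p.2 ∩ nearReturn q.1 q.2) ≤
      2 * (32 * Real.pi ^ 2) ^ 2 * (((q.2 : ℝ) - q.1)⁻¹ * ((pairDist p q : ℝ) + 1)⁻¹) := by
  obtain ⟨k, l⟩ := p
  obtain ⟨k', l'⟩ := q
  simp only at *
  rw [Fin.lt_def] at hq
  rw [Fin.le_def] at h1 h2
  have hcard : (((Finset.Ioo k' l').card : ℕ) : ℝ) + 1 = (l' : ℝ) - k' := by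
    rw [Fin.card_Ioo]
    exact cast_sub_sub_one_add_one hq
  have hpos : (0 : ℝ) < (l' : ℝ) - k' := by
    rw [sub_pos]
    exact_mod_cast hq
  -- With `d` the distance of the pairs, `J` is the overhang of the longer gap on the left or on the
  -- right, whichever realises `d`. It has `d - 1` elements, whence the factor `2`. If neither
  -- overhang is available, `hpq` forces the pairs to coincide and `J = ∅` suffices.
  obtain ⟨J, hJ, hJ', hc⟩ : ∃ J ⊆ Finset.Ioo k l, Disjoint J (Finset.Ioo k' l') ∧
      pairDist (k, l) (k', l') + 1 ≤ 2 * (J.card + 1) := by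
    unfold pairDist
    by_cases ha : (k : ℕ) < k' ∧ ((l : ℤ) - l').natAbs ≤ (k' : ℕ) - k
    · refine ⟨Finset.Ioo k k', ?_, ?_, ?_⟩
      · intro i hi
        simp only [Finset.mem_Ioo, Fin.lt_def] at hi ⊢
        omega
      · rw [Finset.disjoint_left]
        intro i hi hi'
        simp only [Finset.mem_Ioo, Fin.lt_def] at hi hi'
        omega
      · rw [Fin.card_Ioo]
        simp only
        omega
    · by_cases hb : (l' : ℕ) < l
      · refine ⟨Finset.Ioo l' l, ?_, ?_, ?_⟩
        · intro i hi
          simp only [Finset.mem_Ioo, Fin.lt_def] at hi ⊢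
          omega
        · rw [Finset.disjoint_left]
          intro i hi hi'
          simp only [Finset.mem_Ioo, Fin.lt_def] at hi hi'
          omega
        · rw [Fin.card_Ioo]
          simp only
          omega
      · refine ⟨∅, Finset.empty_subset _, Finset.disjoint_empty_left _, ?_⟩
        simp only [Finset.card_empty]
        omega
  refine (measureReal_nearReturn_inter_le hJ hJ').trans ?_
  rw [hcard]
  have hc' : ((pairDist (k, l) (k', l') : ℝ) + 1) ≤ 2 * ((J.card : ℝ) + 1) := by exact_mod_cast hc
  have h3 : ((J.card : ℝ) + 1)⁻¹ ≤ 2 * ((pairDist (k, l) (k', l') : ℝ) + 1)⁻¹ := by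
    rw [← div_eq_mul_inv, inv_eq_one_div, div_le_div_iff₀ (by positivity) (by positivity)]
    linarith
  calc 32 * Real.pi ^ 2 / ((J.card : ℝ) + 1) * (32 * Real.pi ^ 2 / ((l' : ℝ) - k'))
      = (32 * Real.pi ^ 2) ^ 2 * ((l' : ℝ) - k')⁻¹ * ((J.card : ℝ) + 1)⁻¹ := by
        field_simp
    _ ≤ (32 * Real.pi ^ 2) ^ 2 * ((l' : ℝ) - k')⁻¹ *
          (2 * ((pairDist (k, l) (k', l') : ℝ) + 1)⁻¹) := by gcongr
    _ = _ := by ring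

theorem card_filter_natAbs_le {n : ℕ} (l' : Fin n) (x : ℕ) :
    ((Finset.univ : Finset (Fin n)).filter
      (fun l : Fin n => ((l : ℤ) - l').natAbs ≤ x)).card ≤ 2 * x + 1 := by
  have h : ((Finset.univ : Finset (Fin n)).filter
      (fun l : Fin n => ((l : ℤ) - l').natAbs ≤ x)).card ≤
      (Finset.Icc ((l' : ℤ) - x) (l' + x)).card := by
    refine Finset.card_le_card_of_injOn (fun l : Fin n => (l : ℤ)) ?_ ?_
    · intro l hl
      simp only [Finset.coe_filter, Finset.mem_univ, true_and, Set.mem_ofPred_eq] at hl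
      simp only [Finset.coe_Icc, Set.mem_Icc]
      omega
    · intro a _ b _ hab
      simp only at hab
      ext
      omega
  rw [Int.card_Icc] at h
  omega

theorem sum_inv_pairDist_le {n : ℕ} (q : Fin n × Fin n) :
    ∑ p : Fin n × Fin n, ((pairDist p q : ℝ) + 1)⁻¹ ≤ 4 * n := by
  obtain ⟨k', l'⟩ := q
  -- For fixed `k` with `x = |k - a|`, at most `2 * x + 1` indices `l` contribute, each `1 / (x +
  -- 1)`: less than `2` in total. The same bound serves both coordinates as the one realising the
  -- maximum.
  have key : ∀ (a b : Fin n), ∑ k : Fin n, ∑ l : Fin n,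
      (if ((l : ℤ) - b).natAbs ≤ ((k : ℤ) - a).natAbs then
        ((((k : ℤ) - a).natAbs : ℝ) + 1)⁻¹ else 0) ≤ 2 * n := by
    intro a b
    have : ∀ k : Fin n, ∑ l : Fin n, (if ((l : ℤ) - b).natAbs ≤ ((k : ℤ) - a).natAbs then
        ((((k : ℤ) - a).natAbs : ℝ) + 1)⁻¹ else 0) ≤ 2 := by
      intro k
      rw [← Finset.sum_filter, Finset.sum_const, nsmul_eq_mul, ← div_eq_mul_inv,
        div_le_iff₀ (by positivity)]
      have h := card_filter_natAbs_le b ((k : ℤ) - a).natAbs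
      have h' : (((Finset.univ : Finset (Fin n)).filter
        (fun l : Fin n => ((l : ℤ) - b).natAbs ≤ ((k : ℤ) - a).natAbs)).card : ℝ) ≤
          2 * (((k : ℤ) - a).natAbs : ℝ) + 1 := by exact_mod_cast h
      linarith
    refine (Finset.sum_le_sum fun k _ => this k).trans (le_of_eq ?_)
    simp [mul_comm]
  have hsplit : ∀ k l : Fin n, ((pairDist (k, l) (k', l') : ℝ) + 1)⁻¹ ≤
      (if ((l : ℤ) - l').natAbs ≤ ((k : ℤ) - k').natAbs then
        ((((k : ℤ) - k').natAbs : ℝ) + 1)⁻¹ else 0) +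
      (if ((k : ℤ) - k').natAbs ≤ ((l : ℤ) - l').natAbs then
        ((((l : ℤ) - l').natAbs : ℝ) + 1)⁻¹ else 0) := by
    intro k l
    unfold pairDist
    simp only
    rcases le_total ((l : ℤ) - l').natAbs ((k : ℤ) - k').natAbs with h | h
    · rw [max_eq_left h, if_pos h]
      refine le_add_of_nonneg_right ?_
      split_ifs <;> positivity
    · rw [max_eq_right h, if_pos h]
      refine le_add_of_nonneg_left ?_
      split_ifs <;> positivity
  rw [Fintype.sum_prod_type]
  refine (Finset.sum_le_sum fun k _ => Finset.sum_le_sum fun l _ => hsplit k l).trans ?_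
  simp_rw [Finset.sum_add_distrib]
  have h1 := key k' l'
  have h2 := key l' k'
  rw [Finset.sum_comm] at h2
  linarith

/-- The differences `l - k` are distinct positive integers at most `n`, so a harmonic sum dominates.
-/
theorem sum_inv_sub_le {n : ℕ} (k : Fin n) :
    ∑ l ∈ Finset.univ.filter (fun l : Fin n => k < l), ((l : ℝ) - k)⁻¹ ≤ 1 + Real.log n := by
  have h : ∑ l ∈ Finset.univ.filter (fun l : Fin n => k < l), ((l : ℝ) - k)⁻¹ ≤
      ∑ i ∈ Finset.range n, ((i : ℝ) + 1)⁻¹ := by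
    have hinj : Set.InjOn (fun l : Fin n => (l : ℕ) - k - 1)
        (Finset.univ.filter (fun l : Fin n => k < l) : Finset (Fin n)) := by
      intro a ha b hb hab
      simp only [Finset.coe_filter, Finset.mem_univ, true_and, Set.mem_ofPred_eq,
        Fin.lt_def] at ha hb hab
      ext
      omega
    have heq : ∑ l ∈ Finset.univ.filter (fun l : Fin n => k < l), ((l : ℝ) - k)⁻¹ =
        ∑ i ∈ (Finset.univ.filter (fun l : Fin n => k < l)).image
          (fun l : Fin n => (l : ℕ) - k - 1), ((i : ℝ) + 1)⁻¹ := by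
      rw [Finset.sum_image hinj]
      refine Finset.sum_congr rfl fun l hl => ?_
      simp only [Finset.mem_filter, Finset.mem_univ, true_and, Fin.lt_def] at hl
      rw [cast_sub_sub_one_add_one hl]
    rw [heq]
    refine Finset.sum_le_sum_of_subset_of_nonneg ?_ fun i _ _ => by positivity
    intro i hi
    simp only [Finset.mem_image, Finset.mem_filter, Finset.mem_univ, true_and,
      Finset.mem_range, Fin.lt_def] at hi ⊢
    obtain ⟨l, hl, rfl⟩ := hi
    have := l.2
    omega
  refine h.trans ?_
  have := harmonic_le_one_add_log n
  simpa [harmonic] using this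

/-- The pairs of non-adjacent steps. -/
def stepPairs (n : ℕ) : Finset (Fin n × Fin n) :=
  Finset.univ.filter fun p => (p.1 : ℕ) + 2 ≤ p.2

theorem mem_stepPairs {n : ℕ} {p : Fin n × Fin n} :
    p ∈ stepPairs n ↔ (p.1 : ℕ) + 2 ≤ p.2 := by
  simp [stepPairs]

theorem sum_stepPairs_inv_sub_le (n : ℕ) :
    ∑ q ∈ stepPairs n, ((q.2 : ℝ) - q.1)⁻¹ ≤ n * (1 + Real.log n) := by
  have h : ∑ q ∈ stepPairs n, ((q.2 : ℝ) - q.1)⁻¹ ≤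
      ∑ k : Fin n, ∑ l ∈ Finset.univ.filter (fun l : Fin n => k < l), ((l : ℝ) - k)⁻¹ := by
    rw [stepPairs, Finset.sum_filter, Fintype.sum_prod_type]
    simp_rw [Finset.sum_filter]
    refine Finset.sum_le_sum fun k _ => Finset.sum_le_sum fun l _ => ?_
    split_ifs with h1 h2 h2
    · exact le_rfl
    · rw [Fin.lt_def] at h2
      omega
    · rw [inv_nonneg, sub_nonneg]
      exact_mod_cast h2.le
    · exact le_rfl
  refine h.trans ((Finset.sum_le_sum fun k _ => sum_inv_sub_le k).trans (le_of_eq ?_))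
  rw [Finset.sum_const, Finset.card_univ, Fintype.card_fin, nsmul_eq_mul]

/-! ### Covariances and the variance bound -/

/-- The number of crossings as a function of the steps. -/
noncomputable def crossingCount {n : ℕ} (ξ : Fin n → ℂ) : ℝ :=
  ∑ p ∈ stepPairs n, (crossing p.1 p.2).indicator (fun _ => (1 : ℝ)) ξ

theorem memLp_indicator_crossing {n : ℕ} (k l : Fin n) :
    MemLp ((crossing k l).indicator (fun _ => (1 : ℝ))) 2 (stepMeasure n) :=
  (memLp_const 1).indicator (measurableSet_crossing k l)

theorem dependsOn_indicator_crossing {n : ℕ} {k l : Fin n} (hkl : k ≤ l) :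
    DependsOn ((crossing k l).indicator (fun _ => (1 : ℝ)))
      ((Finset.Icc k l : Finset (Fin n)) : Set (Fin n)) := by
  intro ξ η h
  have hk : ξ k = η k := h k (by simp [hkl])
  have hl : ξ l = η l := h l (by simp [hkl])
  have hg : gapSum k l ξ = gapSum k l η := Finset.sum_congr rfl fun i hi => h i (by
    simp only [Finset.mem_Ioo] at hi
    simp [hi.1.le, hi.2.le])
  have : ξ ∈ crossing k l ↔ η ∈ crossing k l := by
    simp only [crossing, Set.mem_ofPred_eq, hk, hl, hg]
  by_cases hη : η ∈ crossing k l
  · rw [Set.indicator_of_mem hη, Set.indicator_of_mem (this.2 hη)]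
  · rw [Set.indicator_of_notMem hη, Set.indicator_of_notMem (mt this.1 hη)]

theorem covariance_crossing_eq_zero {n : ℕ} {p q : Fin n × Fin n} (hp : p.1 ≤ p.2)
    (hq : q.1 ≤ q.2) (h : p.2 < q.1 ∨ q.2 < p.1) :
    cov[(crossing p.1 p.2).indicator (fun _ => (1 : ℝ)),
      (crossing q.1 q.2).indicator (fun _ => (1 : ℝ)); stepMeasure n] = 0 := by
  refine IndepFun.covariance_eq_zero ?_ (memLp_indicator_crossing _ _)
    (memLp_indicator_crossing _ _)
  refine indepFun_of_dependsOn (measurable_const.indicator (measurableSet_crossing _ _))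
    (measurable_const.indicator (measurableSet_crossing _ _)) ?_
    (dependsOn_indicator_crossing hp) (dependsOn_indicator_crossing hq)
  rw [Finset.disjoint_left]
  intro i hi hi'
  simp only [Finset.mem_Icc, Fin.le_def] at hi hi'
  simp only [Fin.lt_def] at h
  omega

/-- The product of the means is nonnegative and is discarded; the variance needs only upper bounds
on covariances. -/
theorem covariance_crossing_le_nearReturn {n : ℕ} (p q : Fin n × Fin n) :
    cov[(crossing p.1 p.2).indicator (fun _ => (1 : ℝ)),
      (crossing q.1 q.2).indicator (fun _ => (1 : ℝ)); stepMeasure n] ≤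
      (stepMeasure n).real (nearReturn p.1 p.2 ∩ nearReturn q.1 q.2) := by
  rw [covariance_eq_sub (memLp_indicator_crossing _ _) (memLp_indicator_crossing _ _)]
  have h0 : ∀ k l : Fin n,
      0 ≤ ∫ ξ, (crossing k l).indicator (fun _ => (1 : ℝ)) ξ ∂stepMeasure n := fun k l =>
    integral_nonneg fun ξ => Set.indicator_nonneg (fun _ _ => zero_le_one) _
  have h1 : (crossing p.1 p.2).indicator (fun _ => (1 : ℝ)) *
      (crossing q.1 q.2).indicator (fun _ => (1 : ℝ)) =
      (crossing p.1 p.2 ∩ crossing q.1 q.2).indicator 1 := by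
    ext ξ
    by_cases hp : ξ ∈ crossing p.1 p.2 <;> by_cases hq : ξ ∈ crossing q.1 q.2 <;> simp [hp, hq]
  rw [h1, integral_indicator_one
    ((measurableSet_crossing _ _).inter (measurableSet_crossing _ _))]
  have h2 : (stepMeasure n).real (crossing p.1 p.2 ∩ crossing q.1 q.2) ≤
      (stepMeasure n).real (nearReturn p.1 p.2 ∩ nearReturn q.1 q.2) :=
    ENNReal.toReal_mono (measure_ne_top _ _) (measure_mono_ae
      ((crossing_ae_le_nearReturn _ _).inter (crossing_ae_le_nearReturn _ _)))
  have := mul_nonneg (h0 p.1 p.2) (h0 q.1 q.2)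
  linarith

/-- Adding the bounds for both orders of the gap lengths gives a symmetric majorant, so the double
sum needs no case split. -/
theorem covariance_crossing_le {n : ℕ} {p q : Fin n × Fin n} (hp : p ∈ stepPairs n)
    (hq : q ∈ stepPairs n) :
    cov[(crossing p.1 p.2).indicator (fun _ => (1 : ℝ)),
      (crossing q.1 q.2).indicator (fun _ => (1 : ℝ)); stepMeasure n] ≤
      2 * (32 * Real.pi ^ 2) ^ 2 * (((q.2 : ℝ) - q.1)⁻¹ * ((pairDist p q : ℝ) + 1)⁻¹) +
      2 * (32 * Real.pi ^ 2) ^ 2 * (((p.2 : ℝ) - p.1)⁻¹ * ((pairDist q p : ℝ) + 1)⁻¹) := by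
  rw [mem_stepPairs] at hp hq
  have hp' : p.1 < p.2 := by rw [Fin.lt_def]; omega
  have hq' : q.1 < q.2 := by rw [Fin.lt_def]; omega
  have hpn : (0 : ℝ) ≤ (p.2 : ℝ) - p.1 := sub_nonneg.2 (by exact_mod_cast hp'.le)
  have hqn : (0 : ℝ) ≤ (q.2 : ℝ) - q.1 := sub_nonneg.2 (by exact_mod_cast hq'.le)
  by_cases hd : p.2 < q.1 ∨ q.2 < p.1
  · rw [covariance_crossing_eq_zero hp'.le hq'.le hd]
    positivity
  · push Not at hd
    refine (covariance_crossing_le_nearReturn p q).trans ?_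
    rcases le_total ((q.2 : ℤ) - q.1) (p.2 - p.1) with h | h
    · refine (measureReal_nearReturn_inter_le_pairDist hq' h hd.2 hd.1).trans ?_
      exact le_add_of_nonneg_right (by positivity)
    · rw [Set.inter_comm]
      refine (measureReal_nearReturn_inter_le_pairDist hp' h hd.1 hd.2).trans ?_
      exact le_add_of_nonneg_left (by positivity)

theorem memLp_crossingCount (n : ℕ) : MemLp (crossingCount (n := n)) 2 (stepMeasure n) :=
  memLp_finsetSum _ fun p _ => memLp_indicator_crossing p.1 p.2

theorem variance_crossingCount_le (n : ℕ) :
    variance (crossingCount (n := n)) (stepMeasure n) ≤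
      16 * (32 * Real.pi ^ 2) ^ 2 * ((n : ℝ) ^ 2 * (1 + Real.log n)) := by
  have hvar : variance (crossingCount (n := n)) (stepMeasure n) =
      ∑ p ∈ stepPairs n, ∑ q ∈ stepPairs n,
        cov[(crossing p.1 p.2).indicator (fun _ => (1 : ℝ)),
          (crossing q.1 q.2).indicator (fun _ => (1 : ℝ)); stepMeasure n] :=
    variance_fun_sum' fun p _ => memLp_indicator_crossing p.1 p.2
  have hS : ∑ q ∈ stepPairs n, ∑ p ∈ stepPairs n,
      2 * (32 * Real.pi ^ 2) ^ 2 * (((q.2 : ℝ) - q.1)⁻¹ * ((pairDist p q : ℝ) + 1)⁻¹) ≤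
      8 * (32 * Real.pi ^ 2) ^ 2 * ((n : ℝ) ^ 2 * (1 + Real.log n)) := by
    simp_rw [← Finset.mul_sum]
    have h1 : ∑ q ∈ stepPairs n, ((q.2 : ℝ) - q.1)⁻¹ *
        ∑ p ∈ stepPairs n, ((pairDist p q : ℝ) + 1)⁻¹ ≤
        ∑ q ∈ stepPairs n, ((q.2 : ℝ) - q.1)⁻¹ * (4 * n) := by
      refine Finset.sum_le_sum fun q hq => ?_
      refine mul_le_mul_of_nonneg_left ?_ ?_
      · refine le_trans ?_ (sum_inv_pairDist_le q)
        exact Finset.sum_le_sum_of_subset_of_nonneg (Finset.subset_univ _)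
          fun _ _ _ => by positivity
      · rw [mem_stepPairs] at hq
        rw [inv_nonneg, sub_nonneg]
        exact_mod_cast (by omega : (q.1 : ℕ) ≤ q.2)
    rw [← Finset.sum_mul] at h1
    have h2 := mul_le_mul_of_nonneg_right (sum_stepPairs_inv_sub_le n)
      (by positivity : (0 : ℝ) ≤ 4 * n)
    calc _ ≤ 2 * (32 * Real.pi ^ 2) ^ 2 * (n * (1 + Real.log n) * (4 * n)) := by
          refine mul_le_mul_of_nonneg_left (h1.trans h2) (by positivity)
      _ = _ := by ring
  rw [hvar]
  refine (Finset.sum_le_sum fun p hp => Finset.sum_le_sum fun q hq =>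
    covariance_crossing_le hp hq).trans ?_
  simp_rw [Finset.sum_add_distrib]
  rw [Finset.sum_comm]
  linarith

/-! ### Crossing probability given a short gap sum -/

/-- The part of the plane above both lines `re = 1 / 2` and `im = 1 / 2`. -/
def upperCorner : Set ℂ := {u | 1 / 2 ≤ u.re ∧ 1 / 2 ≤ u.im}

theorem measurableSet_upperCorner : MeasurableSet upperCorner :=
  (measurableSet_le measurable_const Complex.measurable_re).inter
    (measurableSet_le measurable_const Complex.measurable_im)

theorem uniformUnitCircle_upperCorner_pos : 0 < uniformUnitCircle upperCorner := by
  have hpi := Real.pi_pos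
  rw [uniformUnitCircle, Measure.map_apply measurable_circleParam measurableSet_upperCorner,
    ProbabilityTheory.cond_apply measurableSet_Ioc]
  have hsub : Set.Ioo (Real.pi / 6) (Real.pi / 3) ⊆ Set.Ioc 0 (2 * Real.pi) ∩
      (fun θ : ℝ => Complex.exp (θ * Complex.I)) ⁻¹' upperCorner := by
    rintro θ ⟨h1, h2⟩
    refine ⟨⟨by linarith, by linarith⟩, ?_, ?_⟩
    · simp only [Complex.exp_ofReal_mul_I_re]
      rw [← Real.cos_pi_div_three]
      exact Real.cos_le_cos_of_nonneg_of_le_pi (by linarith) (by linarith) h2.le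
    · simp only [Complex.exp_ofReal_mul_I_im]
      rw [← Real.sin_pi_div_six]
      exact Real.sin_le_sin_of_le_of_le_pi_div_two (by linarith) (by linarith) h1.le
  refine ENNReal.mul_pos ?_ ?_
  · rw [ENNReal.inv_ne_zero, Real.volume_Ioc]
    exact ENNReal.ofReal_ne_top
  · refine (lt_of_lt_of_le ?_ (measure_mono hsub)).ne'
    rw [Real.volume_Ioo, ENNReal.ofReal_pos]
    linarith

/-- Here `u` points into the first quadrant and `v` into the fourth, so `r` is a positive
combination `a u + b v`. Cramer's rule gives `a` and `b`; both are below `1` because `r ≤ 1 / 2`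
while `u.re` and `v.re` are at least `1 / 2`. -/
theorem mem_crossingTriples_of_mem_upperCorner {w u v : ℂ} {r : ℝ} (hr : 0 < r)
    (hr' : r ≤ 1 / 2) (hu : u ∈ upperCorner) (hv : Complex.I * v ∈ upperCorner) :
    (-(r * w), w * u, w * v) ∈ crossingTriples := by
  obtain ⟨hx, hy⟩ := hu
  obtain ⟨hy', hx'⟩ := hv
  simp only [Complex.mul_re, Complex.I_re, Complex.I_im, Complex.mul_im, zero_mul, one_mul,
    zero_sub, zero_add] at hx' hy'
  have h1 : 0 < u.re * -v.im := by apply mul_pos <;> linarith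
  have h2 : 0 < v.re * u.im := by apply mul_pos <;> linarith
  set d : ℝ := u.re * -v.im + v.re * u.im with hd
  have hd0 : 0 < d := by linarith
  refine ⟨r * -v.im / d, ⟨by apply div_pos (mul_pos hr (by linarith)) hd0, ?_⟩,
    r * u.im / d, ⟨by apply div_pos (mul_pos hr (by linarith)) hd0, ?_⟩, ?_⟩
  · rw [div_lt_one hd0]
    nlinarith
  · rw [div_lt_one hd0]
    nlinarith
  · have hdc : (d : ℂ) ≠ 0 := by exact_mod_cast hd0.ne'
    have key : ((r * -v.im / d : ℝ) : ℂ) * u + ((r * u.im / d : ℝ) : ℂ) * v = r := by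
      apply Complex.ext
      · simp only [Complex.add_re, Complex.re_ofReal_mul, Complex.ofReal_re]
        field_simp
        rw [hd]
        ring
      · simp only [Complex.add_im, Complex.im_ofReal_mul, Complex.ofReal_im]
        field_simp
        ring
    simp only
    linear_combination w * key

/-- Rotating by the direction `w` of `-z`, defined since `z ≠ 0`, reduces to the previous
configuration; rotation invariance gives each end step the same mass of good directions. -/
theorem sq_upperCorner_le_crossingTriples_slice {z : ℂ} (hz : z ≠ 0) (hz' : ‖z‖ ≤ 1 / 2) :
    uniformUnitCircle upperCorner ^ 2 ≤
      (uniformUnitCircle.prod uniformUnitCircle) (Prod.mk z ⁻¹' crossingTriples) := by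
  have hn : 0 < ‖z‖ := norm_pos_iff.2 hz
  set w : ℂ := -(z / ‖z‖) with hw
  have hwn : ‖w‖ = 1 := by
    rw [hw, norm_neg, norm_div, Complex.norm_real, norm_norm, div_self hn.ne']
  have hw0 : w ≠ 0 := norm_ne_zero_iff.1 (by rw [hwn]; exact one_ne_zero)
  have hwi : ‖w⁻¹‖ = 1 := by rw [norm_inv, hwn, inv_one]
  have hIwi : ‖Complex.I * w⁻¹‖ = 1 := by rw [norm_mul, hwi, Complex.norm_I, one_mul]
  have hsub : ((fun u => w⁻¹ * u) ⁻¹' upperCorner) ×ˢ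
      ((fun u => Complex.I * w⁻¹ * u) ⁻¹' upperCorner) ⊆ Prod.mk z ⁻¹' crossingTriples := by
    rintro ⟨u, v⟩ ⟨hu, hv⟩
    simp only [Set.mem_preimage] at hu hv ⊢
    rw [mul_assoc] at hv
    have h := mem_crossingTriples_of_mem_upperCorner (w := w) hn hz' hu hv
    have hzc : ((‖z‖ : ℝ) : ℂ) ≠ 0 := by exact_mod_cast hn.ne'
    have hz1 : -(((‖z‖ : ℝ) : ℂ) * w) = z := by
      rw [hw]
      field_simp
    rwa [hz1, mul_inv_cancel_left₀ hw0, mul_inv_cancel_left₀ hw0] at h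
  refine le_trans (le_of_eq ?_) (measure_mono hsub)
  rw [Measure.prod_prod,
    (measurePreserving_mul_uniformUnitCircle hwi).measure_preimage
      measurableSet_upperCorner.nullMeasurableSet,
    (measurePreserving_mul_uniformUnitCircle hIwi).measure_preimage
      measurableSet_upperCorner.nullMeasurableSet, sq]

theorem map_gapSum_prodMk_stepMeasure {n : ℕ} {k l : Fin n} (hkl : k < l) :
    (stepMeasure n).map (fun ξ => (gapSum k l ξ, (ξ k, ξ l))) =
      ((stepMeasure n).map (gapSum k l)).prod (uniformUnitCircle.prod uniformUnitCircle) := by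
  have h1 : IndepFun (gapSum k l) (fun ξ : Fin n → ℂ => (ξ k, ξ l)) (stepMeasure n) := by
    refine indepFun_of_dependsOn (S := Finset.Ioo k l) (T := {k, l}) (measurable_gapSum k l)
      (by fun_prop) ?_ ?_ ?_
    · simp
    · exact fun ξ η h => Finset.sum_congr rfl fun i hi => h i (Finset.mem_coe.2 hi)
    · intro ξ η h
      simp only
      rw [h k (by simp), h l (by simp)]
  have h2 := (iIndepFun_stepMeasure n).indepFun hkl.ne
  rw [h1.map_prod_eq_prod_map_map (measurable_gapSum k l).aemeasurable
    (Measurable.aemeasurable (by fun_prop)),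
    h2.map_prod_eq_prod_map_map (measurable_pi_apply k).aemeasurable
      (measurable_pi_apply l).aemeasurable, map_eval_stepMeasure, map_eval_stepMeasure]

theorem mul_measure_le_measure_crossing {n : ℕ} {k l : Fin n} (hkl : k < l) :
    uniformUnitCircle upperCorner ^ 2 *
      (stepMeasure n) {ξ | gapSum k l ξ ≠ 0 ∧ ‖gapSum k l ξ‖ ≤ 1 / 2} ≤
      (stepMeasure n) (crossing k l) := by
  have hm : Measurable (fun ξ : Fin n → ℂ => (gapSum k l ξ, (ξ k, ξ l))) :=
    (measurable_gapSum k l).prodMk (by fun_prop)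
  have h1 : (stepMeasure n) (crossing k l) =
      ((stepMeasure n).map (fun ξ => (gapSum k l ξ, (ξ k, ξ l)))) crossingTriples := by
    rw [Measure.map_apply hm measurableSet_crossingTriples]
    rfl
  have hDm : MeasurableSet {z : ℂ | z ≠ 0 ∧ ‖z‖ ≤ 1 / 2} :=
    (measurableSet_singleton (0 : ℂ)).compl.inter (measurableSet_le measurable_norm measurable_const)
  have h2 : (stepMeasure n) {ξ | gapSum k l ξ ≠ 0 ∧ ‖gapSum k l ξ‖ ≤ 1 / 2} =
      (stepMeasure n).map (gapSum k l) {z | z ≠ 0 ∧ ‖z‖ ≤ 1 / 2} := by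
    rw [Measure.map_apply (measurable_gapSum k l) hDm]
    rfl
  rw [h1, map_gapSum_prodMk_stepMeasure hkl, Measure.prod_apply measurableSet_crossingTriples, h2,
    ← setLIntegral_const, ← lintegral_indicator hDm]
  refine lintegral_mono fun z => ?_
  by_cases hz : z ∈ {z : ℂ | z ≠ 0 ∧ ‖z‖ ≤ 1 / 2}
  · rw [Set.indicator_of_mem hz]
    exact sq_upperCorner_le_crossingTriples_slice hz.1 hz.2
  · rw [Set.indicator_of_notMem hz]
    exact zero_le

/-- Given all other steps of `J`, one step would have to equal a prescribed point, and the circle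
law has no atoms. -/
theorem stepMeasure_sum_eq_zero {n : ℕ} {J : Finset (Fin n)} (hJ : J.Nonempty) :
    (stepMeasure n) {ξ | ∑ i ∈ J, ξ i = 0} = 0 := by
  obtain ⟨i, hi⟩ := hJ
  have hm : Measurable (fun ξ : Fin n → ℂ => ∑ m ∈ J.erase i, ξ m) := by fun_prop
  have hind : IndepFun (fun ξ : Fin n → ℂ => ξ i) (fun ξ => ∑ m ∈ J.erase i, ξ m)
      (stepMeasure n) := by
    refine indepFun_of_dependsOn (S := {i}) (T := J.erase i) (measurable_pi_apply i) hm
      (by simp) ?_ ?_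
    · exact fun ξ η h => h i (by simp)
    · exact fun ξ η h => Finset.sum_congr rfl fun m hm => h m (Finset.mem_coe.2 hm)
  have hmap := hind.map_prod_eq_prod_map_map (measurable_pi_apply i).aemeasurable hm.aemeasurable
  have : IsProbabilityMeasure ((stepMeasure n).map (fun ξ => ∑ m ∈ J.erase i, ξ m)) :=
    Measure.isProbabilityMeasure_map hm.aemeasurable
  have hB : MeasurableSet {p : ℂ × ℂ | p.1 + p.2 = 0} :=
    measurableSet_eq_fun (by fun_prop) measurable_const
  have h1 : (stepMeasure n) {ξ | ∑ i ∈ J, ξ i = 0} =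
      ((stepMeasure n).map (fun ξ => (ξ i, ∑ m ∈ J.erase i, ξ m))) {p | p.1 + p.2 = 0} := by
    rw [Measure.map_apply (by fun_prop) hB]
    congr 1
    ext ξ
    simp [Finset.add_sum_erase J (fun m => ξ m) hi]
  rw [h1, hmap, map_eval_stepMeasure, Measure.prod_apply_symm hB]
  have h0 : ∀ y : ℂ, uniformUnitCircle ((fun x => (x, y)) ⁻¹' {p : ℂ × ℂ | p.1 + p.2 = 0}) = 0 := by
    intro y
    have : (fun x => (x, y)) ⁻¹' {p : ℂ × ℂ | p.1 + p.2 = 0} = {-y} := by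
      ext x
      simp [add_eq_zero_iff_eq_neg]
    rw [this, uniformUnitCircle_singleton]
  rw [lintegral_congr h0, lintegral_zero]

/-! ### The local limit lower bound -/

theorem integral_clm_uniformUnitCircle (L : ℂ →L[ℝ] ℝ) : ∫ z, L z ∂uniformUnitCircle = 0 := by
  have h := integral_comp_mul_uniformUnitCircle (w := -1) (by simp) (f := fun z => L z)
    L.continuous.stronglyMeasurable
  simp only [neg_mul, one_mul, map_neg, integral_neg] at h
  linarith

theorem memLp_clm_eval {n : ℕ} {L : ℂ →L[ℝ] ℝ} (hL : ∀ z, |L z| ≤ ‖z‖) (i : Fin n) :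
    MemLp (fun ξ : Fin n → ℂ => L (ξ i)) 2 (stepMeasure n) := by
  refine MemLp.of_bound (C := 1) (Measurable.aestronglyMeasurable (by fun_prop)) ?_
  filter_upwards [ae_norm_eq_one_stepMeasure i] with ξ hξ
  rw [← hξ]
  exact hL _

theorem measureReal_clm_sum_ge_le {n : ℕ} {L : ℂ →L[ℝ] ℝ} (hL : ∀ z, |L z| ≤ ‖z‖)
    (J : Finset (Fin n)) {R : ℝ} (hR : 0 < R) :
    (stepMeasure n).real {ξ | R ≤ |L (∑ i ∈ J, ξ i)|} ≤ J.card / R ^ 2 := by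
  have hmem : MemLp (∑ i ∈ J, fun ξ : Fin n → ℂ => L (ξ i)) 2 (stepMeasure n) :=
    memLp_finsetSum' _ fun i _ => memLp_clm_eval hL i
  have hvar : variance (∑ i ∈ J, fun ξ : Fin n → ℂ => L (ξ i)) (stepMeasure n) ≤ J.card := by
    rw [IndepFun.variance_sum (fun i _ => memLp_clm_eval hL i)]
    · refine (Finset.sum_le_sum (g := fun _ => (1 : ℝ)) fun i _ => ?_).trans (by simp)
      refine (variance_le_expectation_sq (memLp_clm_eval hL i).aestronglyMeasurable).trans ?_
      have h1 : ∫ _, (1 : ℝ) ∂stepMeasure n = 1 := by simp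
      rw [← h1]
      refine integral_mono_ae (memLp_clm_eval hL i).integrable_sq (integrable_const _) ?_
      filter_upwards [ae_norm_eq_one_stepMeasure i] with ξ hξ
      have := hL (ξ i)
      rw [hξ] at this
      simp only [Pi.pow_apply]
      rw [← sq_abs]
      exact pow_le_one₀ (abs_nonneg _) this
    · intro i _ j _ hij
      exact ((iIndepFun_stepMeasure n).indepFun hij).comp L.measurable L.measurable
  have hmean : ∫ ξ, (∑ i ∈ J, fun ξ : Fin n → ℂ => L (ξ i)) ξ ∂stepMeasure n = 0 := by
    simp only [Finset.sum_apply]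
    rw [integral_finsetSum _ fun i _ => (memLp_clm_eval hL i).integrable (by norm_num)]
    refine Finset.sum_eq_zero fun i _ => ?_
    rw [← integral_clm_uniformUnitCircle L, ← map_eval_stepMeasure i,
      integral_map (measurable_pi_apply i).aemeasurable L.continuous.aestronglyMeasurable]
  have h := meas_ge_le_variance_div_sq hmem hR
  rw [hmean] at h
  simp only [Finset.sum_apply, sub_zero, ← map_sum] at h
  have h2 := ENNReal.toReal_mono ENNReal.ofReal_ne_top h
  rw [ENNReal.toReal_ofReal (div_nonneg (variance_nonneg _ _) (by positivity))] at h2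
  refine h2.trans ?_
  gcongr

/-- Two independent points of the same law, concentrated on a square of side length `4 r`, have
distance at most `1 / 2` with probability of order at least `1 / r ^ 2`. -/
theorem le_measureReal_prod_dist_le (ν : Measure ℂ) [IsProbabilityMeasure ν] {r : ℕ} (hr : 0 < r)
    (hν : 1 / 2 ≤ ν.real {z | |z.re| < 2 * r ∧ |z.im| < 2 * r}) :
    1 / (1024 * (r : ℝ) ^ 2) ≤ (ν.prod ν).real {p | ‖p.1 - p.2‖ ≤ 1 / 2} := by
  -- Cells of side `1 / 4`: points of one cell are closer than `1 / 2`, and `256 * r ^ 2` cells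
  -- cover the square. Cauchy–Schwarz bounds the probability of sharing a cell below by `(1 / 2) ^ 2
  -- / (256 * r ^ 2)`.
  set f : ℂ → ℤ × ℤ := fun z => (⌊4 * z.re⌋, ⌊4 * z.im⌋) with hf
  have hfm : Measurable f := by
    refine Measurable.prodMk ?_ ?_
    · exact Int.measurable_floor.comp (Complex.measurable_re.const_mul 4)
    · exact Int.measurable_floor.comp (Complex.measurable_im.const_mul 4)
  have hfs : ∀ t, MeasurableSet (f ⁻¹' {t}) := fun t => hfm (measurableSet_singleton t)
  set T : Finset (ℤ × ℤ) := Finset.Ico (-(8 * r : ℤ)) (8 * r) ×ˢ Finset.Ico (-(8 * r : ℤ)) (8 * r)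
    with hT
  have hcard : (T.card : ℝ) = 256 * (r : ℝ) ^ 2 := by
    have : T.card = (16 * r) * (16 * r) := by
      rw [hT, Finset.card_product, Int.card_Ico]
      congr 1 <;> omega
    rw [this]
    push_cast
    ring
  have hfin : ν (⋃ t ∈ T, f ⁻¹' {t}) ≠ ⊤ := measure_ne_top _ _
  have hdisj : Set.PairwiseDisjoint (T : Set (ℤ × ℤ)) fun t => f ⁻¹' {t} := by
    intro s _ t _ hst
    exact Disjoint.preimage f (by simpa using hst)
  have hsum : 1 / 2 ≤ ∑ t ∈ T, ν.real (f ⁻¹' {t}) := by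
    rw [← measureReal_biUnion_finset hdisj fun t _ => hfs t]
    refine hν.trans (measureReal_mono ?_ hfin)
    rintro z ⟨h1, h2⟩
    rw [abs_lt] at h1 h2
    simp only [Set.mem_iUnion, Set.mem_preimage, Set.mem_singleton_iff, exists_prop,
      exists_eq_right', hT, hf, Finset.mem_product, Finset.mem_Ico]
    refine ⟨⟨?_, ?_⟩, ?_, ?_⟩
    · rw [Int.le_floor]
      push_cast
      linarith
    · rw [Int.floor_lt]
      push_cast
      linarith
    · rw [Int.le_floor]
      push_cast
      linarith
    · rw [Int.floor_lt]
      push_cast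
      linarith
  have hprod : ∑ t ∈ T, ν.real (f ⁻¹' {t}) ^ 2 ≤ (ν.prod ν).real {p | ‖p.1 - p.2‖ ≤ 1 / 2} := by
    have h1 : ∀ t, ν.real (f ⁻¹' {t}) ^ 2 = (ν.prod ν).real ((f ⁻¹' {t}) ×ˢ (f ⁻¹' {t})) := by
      intro t
      rw [measureReal_prod_prod, sq]
    simp_rw [h1]
    rw [← measureReal_biUnion_finset ?_ fun t _ => (hfs t).prod (hfs t)]
    · refine measureReal_mono ?_
      rintro ⟨y, z⟩ hp
      simp only [Set.mem_iUnion, Set.mem_prod, Set.mem_preimage, Set.mem_singleton_iff,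
        exists_prop] at hp
      obtain ⟨t, -, hy, hz⟩ := hp
      have hyz : f y = f z := hy.trans hz.symm
      simp only [hf, Prod.mk.injEq] at hyz
      have hre := Int.abs_sub_lt_one_of_floor_eq_floor hyz.1
      have him := Int.abs_sub_lt_one_of_floor_eq_floor hyz.2
      rw [abs_lt] at hre him
      simp only [Set.mem_ofPred_eq]
      rw [← abs_of_nonneg (norm_nonneg (y - z)), ← abs_of_nonneg (by norm_num : (0 : ℝ) ≤ 1 / 2),
        ← sq_le_sq, Complex.sq_norm, Complex.normSq_apply, Complex.sub_re, Complex.sub_im]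
      nlinarith
    · intro s hs t ht hst
      exact Set.disjoint_prod.2 (Or.inl (hdisj hs ht hst))
  have hcs := sq_sum_le_card_mul_sum_sq (s := T) (f := fun t => ν.real (f ⁻¹' {t}))
  rw [hcard] at hcs
  have hr' : (0 : ℝ) < r := by exact_mod_cast hr
  rw [div_le_iff₀ (by positivity)]
  have h4 : (1 / 2 : ℝ) ^ 2 ≤ (∑ t ∈ T, ν.real (f ⁻¹' {t})) ^ 2 := by gcongr
  have h5 := mul_le_mul_of_nonneg_left hprod (by positivity : (0 : ℝ) ≤ 256 * (r : ℝ) ^ 2)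
  linarith

/-- The step law has a real characteristic function, so a sum and its negative agree in law. This
turns a sum over two halves into a difference of two i.i.d. variables. -/
theorem map_neg_sum_stepMeasure {n : ℕ} {J J' : Finset (Fin n)} (h : J.card = J'.card) :
    (stepMeasure n).map (fun ξ => -∑ i ∈ J', ξ i) =
      (stepMeasure n).map (fun ξ => ∑ i ∈ J, ξ i) := by
  have hm : ∀ K : Finset (Fin n), Measurable (fun ξ : Fin n → ℂ => ∑ i ∈ K, ξ i) :=
    fun K => by fun_prop
  have hmn : Measurable (fun ξ : Fin n → ℂ => -∑ i ∈ J', ξ i) := by fun_prop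
  have : IsProbabilityMeasure ((stepMeasure n).map (fun ξ => ∑ i ∈ J, ξ i)) :=
    Measure.isProbabilityMeasure_map (hm J).aemeasurable
  have : IsProbabilityMeasure ((stepMeasure n).map (fun ξ => -∑ i ∈ J', ξ i)) :=
    Measure.isProbabilityMeasure_map hmn.aemeasurable
  refine Measure.ext_of_charFun ?_
  ext t
  have h1 : charFun ((stepMeasure n).map (fun ξ => -∑ i ∈ J', ξ i)) t =
      charFun ((stepMeasure n).map (fun ξ => ∑ i ∈ J', ξ i)) (-t) := by
    rw [charFun_apply, charFun_apply, integral_map hmn.aemeasurable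
      (Measurable.aestronglyMeasurable (by fun_prop)), integral_map (hm J').aemeasurable
      (Measurable.aestronglyMeasurable (by fun_prop))]
    simp only [inner_neg_left, inner_neg_right]
  rw [h1, charFun_map_sum_stepMeasure, charFun_map_sum_stepMeasure, h,
    charFun_neg, charFun_uniformUnitCircle_eq_integral_cos, Complex.conj_ofReal]

/-- The local limit lower bound for sums of an even number of steps. -/
theorem le_measureReal_norm_sum_le {n : ℕ} {J J' : Finset (Fin n)} (hJJ' : Disjoint J J')
    (h : J.card = J'.card) (hJ : 0 < J.card) :
    1 / (4096 * (J.card : ℝ)) ≤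
      (stepMeasure n).real {ξ | ‖∑ i ∈ J ∪ J', ξ i‖ ≤ 1 / 2} := by
  have hm : ∀ K : Finset (Fin n), Measurable (fun ξ : Fin n → ℂ => ∑ i ∈ K, ξ i) :=
    fun K => by fun_prop
  have hmn : Measurable (fun ξ : Fin n → ℂ => -∑ i ∈ J', ξ i) := by fun_prop
  set ν := (stepMeasure n).map (fun ξ => ∑ i ∈ J, ξ i) with hν
  have : IsProbabilityMeasure ν := Measure.isProbabilityMeasure_map (hm J).aemeasurable
  have hind : IndepFun (fun ξ : Fin n → ℂ => ∑ i ∈ J, ξ i) (fun ξ => -∑ i ∈ J', ξ i)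
      (stepMeasure n) := by
    refine indepFun_of_dependsOn (hm J) hmn hJJ' ?_ ?_
    · exact fun ξ η h => Finset.sum_congr rfl fun i hi => h i (Finset.mem_coe.2 hi)
    · exact fun ξ η h => congrArg Neg.neg
        (Finset.sum_congr rfl fun i hi => h i (Finset.mem_coe.2 hi))
  have hmap := hind.map_prod_eq_prod_map_map (hm J).aemeasurable hmn.aemeasurable
  rw [map_neg_sum_stepMeasure h] at hmap
  have hB : MeasurableSet {p : ℂ × ℂ | ‖p.1 - p.2‖ ≤ 1 / 2} :=
    measurableSet_le (by fun_prop) measurable_const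
  have heq : (stepMeasure n).real {ξ | ‖∑ i ∈ J ∪ J', ξ i‖ ≤ 1 / 2} =
      (ν.prod ν).real {p | ‖p.1 - p.2‖ ≤ 1 / 2} := by
    rw [hν, ← hmap, map_measureReal_apply ((hm J).prodMk hmn) hB]
    congr 1
    ext ξ
    simp [Finset.sum_union hJJ']
  -- The scale satisfies `#J ≤ r ^ 2 ≤ 4 * #J`: the left inequality makes Chebyshev lose at most `1
  -- / 4` per coordinate, the right one turns `1024` into `4096`.
  set r := Nat.sqrt J.card + 1 with hr
  have hr1 : (J.card : ℝ) ≤ (r : ℝ) ^ 2 := by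
    have := Nat.lt_succ_sqrt J.card
    rw [sq]
    exact_mod_cast this.le
  have hr2 : (r : ℝ) ^ 2 ≤ 4 * J.card := by
    have h1 := Nat.sqrt_le J.card
    have h2 : 0 < Nat.sqrt J.card := Nat.sqrt_pos.2 hJ
    have : r ^ 2 ≤ 4 * J.card := by
      rw [hr]
      nlinarith
    exact_mod_cast this
  have hr0 : 0 < r := Nat.succ_pos _
  have hr0' : (0 : ℝ) < r := by exact_mod_cast hr0
  have hJ' : (0 : ℝ) < J.card := by exact_mod_cast hJ
  have hbox : 1 / 2 ≤ ν.real {z | |z.re| < 2 * r ∧ |z.im| < 2 * r} := by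
    have hbm : MeasurableSet {z : ℂ | |z.re| < 2 * r ∧ |z.im| < 2 * r} :=
      (measurableSet_lt Complex.measurable_re.abs measurable_const).inter
        (measurableSet_lt Complex.measurable_im.abs measurable_const)
    rw [hν, map_measureReal_apply (hm J) hbm]
    set A := (fun ξ : Fin n → ℂ => ∑ i ∈ J, ξ i) ⁻¹' {z : ℂ | |z.re| < 2 * r ∧ |z.im| < 2 * r}
      with hA
    have hAm : MeasurableSet A := (hm J) hbm
    have hc : (stepMeasure n).real Aᶜ ≤ 1 / 2 := by
      have hsub : Aᶜ ⊆ {ξ | 2 * (r : ℝ) ≤ |Complex.reCLM (∑ i ∈ J, ξ i)|} ∪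
          {ξ | 2 * (r : ℝ) ≤ |Complex.imCLM (∑ i ∈ J, ξ i)|} := by
        intro ξ hξ
        rw [Set.mem_compl_iff, hA, Set.mem_preimage, Set.mem_ofPred_eq, not_and_or, not_lt,
          not_lt] at hξ
        exact hξ
      have h1 := measureReal_clm_sum_ge_le (L := Complex.reCLM) Complex.abs_re_le_norm J
        (R := 2 * r) (by positivity)
      have h2 := measureReal_clm_sum_ge_le (L := Complex.imCLM) Complex.abs_im_le_norm J
        (R := 2 * r) (by positivity)
      have h3 : (J.card : ℝ) / (2 * r) ^ 2 ≤ 1 / 4 := by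
        rw [div_le_iff₀ (by positivity)]
        linarith
      have h4 := (measureReal_mono (μ := stepMeasure n) hsub).trans (measureReal_union_le _ _)
      linarith
    have := probReal_add_probReal_compl (μ := stepMeasure n) hAm
    linarith
  rw [heq]
  refine le_trans ?_ (le_measureReal_prod_dist_le ν hr0 hbox)
  apply one_div_le_one_div_of_le (by positivity)
  linarith

/-! ### The lower bound for the mean -/

theorem le_measureReal_crossing {n : ℕ} {k l : Fin n} {j : ℕ} (hl : (l : ℕ) = k + 2 * j + 3) :
    uniformUnitCircle.real upperCorner ^ 2 / 4096 * ((j : ℝ) + 1)⁻¹ ≤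
      (stepMeasure n).real (crossing k l) := by
  have hkl : k < l := by rw [Fin.lt_def]; omega
  have hmid : (k : ℕ) + j + 2 < n := by have := l.2; omega
  -- The gap has `2 * j + 2` steps; `m` splits it into halves of `j + 1`.
  set m : Fin n := ⟨k + j + 2, hmid⟩ with hmdef
  have hmv : (m : ℕ) = k + j + 2 := rfl
  have hU : Finset.Ioo k l = Finset.Ioo k m ∪ Finset.Ico m l := by
    ext i
    simp only [Finset.mem_union, Finset.mem_Ioo, Finset.mem_Ico, Fin.lt_def, Fin.le_def]
    omega
  have hd : Disjoint (Finset.Ioo k m) (Finset.Ico m l) := by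
    rw [Finset.disjoint_left]
    intro i
    simp only [Finset.mem_Ioo, Finset.mem_Ico, Fin.lt_def, Fin.le_def]
    omega
  have hc1 : (Finset.Ioo k m).card = j + 1 := by
    rw [Fin.card_Ioo]
    omega
  have hc2 : (Finset.Ico m l).card = j + 1 := by
    rw [Fin.card_Ico]
    omega
  have h1 := le_measureReal_norm_sum_le hd (hc1.trans hc2.symm) (by omega)
  rw [← hU, hc1] at h1
  have h2 : (stepMeasure n) {ξ | gapSum k l ξ ≠ 0 ∧ ‖gapSum k l ξ‖ ≤ 1 / 2} =
      (stepMeasure n) {ξ | ‖∑ i ∈ Finset.Ioo k l, ξ i‖ ≤ 1 / 2} := by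
    refine measure_congr ?_
    have hne : (Finset.Ioo k l).Nonempty := by
      rw [← Finset.card_pos, Fin.card_Ioo]
      omega
    have h0 : ∀ᵐ ξ ∂stepMeasure n, ∑ i ∈ Finset.Ioo k l, ξ i ≠ 0 := by
      rw [ae_iff]
      simpa using stepMeasure_sum_eq_zero hne
    filter_upwards [h0] with ξ hξ
    exact propext ⟨fun h => h.2, fun h => ⟨hξ, h⟩⟩
  have h3 := ENNReal.toReal_mono (measure_ne_top _ _) (mul_measure_le_measure_crossing hkl)
  rw [ENNReal.toReal_mul, ENNReal.toReal_pow, h2] at h3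
  refine le_trans ?_ h3
  change _ ≤ uniformUnitCircle.real upperCorner ^ 2 *
    (stepMeasure n).real {ξ | ‖∑ i ∈ Finset.Ioo k l, ξ i‖ ≤ 1 / 2}
  rw [div_mul_eq_mul_div, mul_div_assoc]
  refine mul_le_mul_of_nonneg_left (le_trans (le_of_eq ?_) h1) (sq_nonneg _)
  push_cast
  field_simp

theorem integral_crossingCount (n : ℕ) : ∫ ξ, crossingCount ξ ∂stepMeasure n =
    ∑ p ∈ stepPairs n, (stepMeasure n).real (crossing p.1 p.2) := by
  unfold crossingCount
  rw [integral_finsetSum _ fun p _ => (memLp_indicator_crossing p.1 p.2).integrable (by norm_num)]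
  exact Finset.sum_congr rfl fun p _ => integral_indicator_one (measurableSet_crossing _ _)

theorem sum_le_integral_crossingCount (n : ℕ) :
    ((n / 2 : ℕ) : ℝ) * (uniformUnitCircle.real upperCorner ^ 2 / 4096 *
      ∑ j ∈ Finset.range (n / 8), ((j : ℝ) + 1)⁻¹) ≤ ∫ ξ, crossingCount ξ ∂stepMeasure n := by
  -- Only odd index differences `2 * j + 3` are counted, so that the gap is even; the ranges keep
  -- the second index below `3 n / 4`.
  set e : Fin (n / 2) × Fin (n / 8) → Fin n × Fin n := fun q =>
    (⟨q.1, by have := q.1.2; omega⟩, ⟨q.1 + 2 * q.2 + 3, by have := q.1.2; have := q.2.2; omega⟩)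
    with he
  have hinj : Function.Injective e := by
    rintro ⟨a, b⟩ ⟨c, d⟩ h
    simp only [he, Prod.mk.injEq, Fin.mk.injEq] at h
    ext <;> simp only <;> omega
  rw [integral_crossingCount]
  have h1 : ∑ p ∈ Finset.univ.image e, (stepMeasure n).real (crossing p.1 p.2) ≤
      ∑ p ∈ stepPairs n, (stepMeasure n).real (crossing p.1 p.2) := by
    refine Finset.sum_le_sum_of_subset_of_nonneg ?_ fun _ _ _ => measureReal_nonneg
    intro p hp
    obtain ⟨q, -, rfl⟩ := Finset.mem_image.1 hp
    rw [mem_stepPairs]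
    simp only [he]
    omega
  refine le_trans ?_ h1
  rw [Finset.sum_image hinj.injOn, Fintype.sum_prod_type]
  have h2 : ∀ a : Fin (n / 2), uniformUnitCircle.real upperCorner ^ 2 / 4096 *
      ∑ j ∈ Finset.range (n / 8), ((j : ℝ) + 1)⁻¹ ≤
      ∑ b : Fin (n / 8), (stepMeasure n).real (crossing (e (a, b)).1 (e (a, b)).2) := by
    intro a
    rw [← Fin.sum_univ_eq_sum_range (fun j => ((j : ℝ) + 1)⁻¹), Finset.mul_sum]
    exact Finset.sum_le_sum fun b _ => le_measureReal_crossing rfl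
  refine le_trans (le_of_eq ?_) (Finset.sum_le_sum fun a _ => h2 a)
  rw [Finset.sum_const, Finset.card_univ, Fintype.card_fin, nsmul_eq_mul]

theorem exists_le_integral_crossingCount : ∃ c : ℝ, 0 < c ∧ ∀ n : ℕ, 64 ≤ n →
    c * (n * Real.log n) ≤ ∫ ξ, crossingCount ξ ∂stepMeasure n := by
  have hpos : 0 < uniformUnitCircle.real upperCorner :=
    ENNReal.toReal_pos uniformUnitCircle_upperCorner_pos.ne' (measure_ne_top _ _)
  refine ⟨uniformUnitCircle.real upperCorner ^ 2 / 4096 / 8, by positivity, fun n hn => ?_⟩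
  refine le_trans ?_ (sum_le_integral_crossingCount n)
  have hn' : (64 : ℝ) ≤ n := by exact_mod_cast hn
  have h1 : (n : ℝ) / 4 ≤ ((n / 2 : ℕ) : ℝ) := by
    have : (n : ℝ) ≤ 4 * ((n / 2 : ℕ) : ℝ) := by exact_mod_cast (by omega : n ≤ 4 * (n / 2))
    linarith
  have h2 : Real.log n / 2 ≤ ∑ j ∈ Finset.range (n / 8), ((j : ℝ) + 1)⁻¹ := by
    have h3 := log_add_one_le_harmonic (n / 8)
    have h4 : ((harmonic (n / 8) : ℚ) : ℝ) = ∑ j ∈ Finset.range (n / 8), ((j : ℝ) + 1)⁻¹ := by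
      simp [harmonic]
    rw [h4] at h3
    refine le_trans ?_ h3
    -- The threshold `64` gives `n / 8 + 1 ≥ 8`, so its square exceeds `n` and its logarithm is at
    -- least half of `log n`.
    have h5 : (n : ℝ) ≤ (((n / 8 : ℕ) : ℝ) + 1) ^ 2 := by
      have : (n : ℝ) ≤ 8 * (((n / 8 : ℕ) : ℝ) + 1) := by
        exact_mod_cast (by omega : n ≤ 8 * (n / 8 + 1))
      nlinarith
    have h6 := Real.log_le_log (by linarith) h5
    rw [Real.log_pow] at h6
    push_cast at h6 ⊢
    linarith
  have hlog : 0 ≤ Real.log n := Real.log_nonneg (by linarith)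
  calc uniformUnitCircle.real upperCorner ^ 2 / 4096 / 8 * (n * Real.log n)
      = (n / 4) * (uniformUnitCircle.real upperCorner ^ 2 / 4096 * (Real.log n / 2)) := by ring
    _ ≤ _ := by gcongr
-- From the walk to its steps
theorem sum_Ioo_succ_sub_castSucc {n : ℕ} (x : Fin (n + 1) → ℂ) {k l : Fin n} (hkl : k < l) :
    ∑ i ∈ Finset.Ioo k l, (x i.succ - x i.castSucc) = x l.castSucc - x k.succ := by
  set y : ℕ → ℂ := fun m => if h : m < n + 1 then x ⟨m, h⟩ else 0 with hy
  have h1 : ∀ i : Fin n, x i.succ = y ((i : ℕ) + 1) := by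
    intro i
    have := i.2
    simp only [hy]
    rw [dif_pos (by omega)]
    rfl
  have h2 : ∀ i : Fin n, x i.castSucc = y i := by
    intro i
    have := i.2
    simp only [hy]
    rw [dif_pos (by omega)]
    rfl
  have h3 : ∑ i ∈ Finset.Ioo k l, (x i.succ - x i.castSucc) =
      ∑ m ∈ Finset.Ico ((k : ℕ) + 1) l, (y (m + 1) - y m) := by
    rw [show Finset.Ico ((k : ℕ) + 1) l = (Finset.Ioo k l).map Fin.valEmbedding by
      rw [Fin.map_valEmbedding_Ioo]
      ext m
      simp only [Finset.mem_Ico, Finset.mem_Ioo]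
      omega, Finset.sum_map]
    exact Finset.sum_congr rfl fun i _ => by rw [h1, h2]; rfl
  rw [h3, Finset.sum_Ico_eq_sub _ (by rw [Fin.lt_def] at hkl; omega), Finset.sum_range_sub,
    Finset.sum_range_sub, h1, h2]
  ring

/-- In `crossing`, `a` is the fraction of segment `k` after the common point, hence `1 - s`, and `b`
the fraction of segment `l` before it; the closed loop sums to zero. -/
theorem openSegment_inter_nonempty_iff {n : ℕ} (x : Fin (n + 1) → ℂ) {k l : Fin n} (hkl : k < l) :
    (openSegment ℝ (x k.castSucc) (x k.succ) ∩
      openSegment ℝ (x l.castSucc) (x l.succ)).Nonempty ↔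
      (fun i : Fin n => x i.succ - x i.castSucc) ∈ crossing k l := by
  simp only [crossing, Set.mem_ofPred_eq, gapSum, sum_Ioo_succ_sub_castSucc x hkl]
  rw [openSegment_eq_image', openSegment_eq_image']
  constructor
  · rintro ⟨z, ⟨s, hs, rfl⟩, ⟨t, ht, h⟩⟩
    refine ⟨1 - s, ⟨by linarith [hs.2], by linarith [hs.1]⟩, t, ht, ?_⟩
    simp only [Complex.real_smul] at h
    push_cast
    linear_combination h
  · rintro ⟨a, ha, b, hb, h⟩
    refine ⟨_, ⟨1 - a, ⟨by linarith [ha.2], by linarith [ha.1]⟩, rfl⟩, ⟨b, hb, ?_⟩⟩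
    simp only [Complex.real_smul]
    push_cast
    linear_combination h

theorem selfIntersectionCount_eq_crossingCount {Ω : Type u} {n : ℕ} (X : Fin (n + 1) → Ω → ℂ)
    (ω : Ω) : selfIntersectionCount X ω =
      crossingCount (fun k : Fin n => X k.succ ω - X k.castSucc ω) := by
  classical
  have hset : {p : Fin n × Fin n | (p.1 : ℕ) + 2 ≤ (p.2 : ℕ) ∧
      (openSegment ℝ (X p.1.castSucc ω) (X p.1.succ ω) ∩
        openSegment ℝ (X p.2.castSucc ω) (X p.2.succ ω)).Nonempty} =
      (((stepPairs n).filter fun p => (fun k : Fin n => X k.succ ω - X k.castSucc ω) ∈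
        crossing p.1 p.2 : Finset (Fin n × Fin n)) : Set (Fin n × Fin n)) := by
    ext p
    simp only [Set.mem_ofPred_eq, Finset.coe_filter, mem_stepPairs]
    refine and_congr_right fun hp => ?_
    exact openSegment_inter_nonempty_iff (fun k => X k ω) (by rw [Fin.lt_def]; omega)
  rw [selfIntersectionCount, numSelfIntersections, hset, Set.ncard_coe_finset, crossingCount,
    Finset.card_filter]
  push_cast
  refine Finset.sum_congr rfl fun p _ => ?_
  simp [Set.indicator]

theorem IsEquilateralIsotropicWalk.hasLaw_steps {Ω : Type u} [MeasurableSpace Ω] {P : Measure Ω}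
    [IsProbabilityMeasure P] {n : ℕ} {X : Fin (n + 1) → Ω → ℂ}
    (hX : IsEquilateralIsotropicWalk P X) :
    HasLaw (fun ω (k : Fin n) => X k.succ ω - X k.castSucc ω) (stepMeasure n) P :=
  hX.indep.hasLaw_pi hX.law

/-! ### Chebyshev and the conclusion -/

theorem chebyshev_measureReal_le {Ω : Type u} [MeasurableSpace Ω] {P : Measure Ω}
    [IsProbabilityMeasure P] {K : Ω → ℝ} (hK : MemLp K 2 P) {c : ℝ} (hc : 0 < c) :
    P.real {ω | c < |K ω - ∫ ω', K ω' ∂P|} ≤ variance K P / c ^ 2 := by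
  have h := ENNReal.toReal_mono ENNReal.ofReal_ne_top (meas_ge_le_variance_div_sq hK hc)
  rw [ENNReal.toReal_ofReal (div_nonneg (variance_nonneg _ _) (by positivity))] at h
  refine (measureReal_mono ?_).trans h
  exact fun ω (hω : c < _) => hω.le

theorem variance_crossingCount_le_mul_log {n : ℕ} (hn : 2 ≤ n) :
    variance (crossingCount (n := n)) (stepMeasure n) ≤
      48 * (32 * Real.pi ^ 2) ^ 2 * ((n : ℝ) ^ 2 * Real.log n) := by
  refine (variance_crossingCount_le n).trans ?_
  have h1 : Real.log 2 ≤ Real.log n := Real.log_le_log (by norm_num) (by exact_mod_cast hn)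
  have h2 := Real.log_two_gt_d9
  -- Uses `log n ≥ log 2 > 1 / 2`; this is where `n ≥ 2` enters.
  have h3 : 1 + Real.log n ≤ 3 * Real.log n := by linarith
  calc 16 * (32 * Real.pi ^ 2) ^ 2 * ((n : ℝ) ^ 2 * (1 + Real.log n))
      ≤ 16 * (32 * Real.pi ^ 2) ^ 2 * ((n : ℝ) ^ 2 * (3 * Real.log n)) := by gcongr
    _ = _ := by ring

theorem selfIntersectionCount_eq_comp {Ω : Type u} {n : ℕ}
    (X : Fin (n + 1) → Ω → ℂ) : selfIntersectionCount X =
      crossingCount ∘ (fun ω (k : Fin n) => X k.succ ω - X k.castSucc ω) :=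
  funext fun ω => selfIntersectionCount_eq_crossingCount X ω

theorem IsEquilateralIsotropicWalk.memLp_selfIntersectionCount {Ω : Type u} [MeasurableSpace Ω]
    {P : Measure Ω} [IsProbabilityMeasure P] {n : ℕ} {X : Fin (n + 1) → Ω → ℂ}
    (hX : IsEquilateralIsotropicWalk P X) : MemLp (selfIntersectionCount X) 2 P := by
  have h := memLp_crossingCount n
  rw [selfIntersectionCount_eq_comp]
  rw [← hX.hasLaw_steps.map_eq] at h
  exact h.comp_of_map hX.hasLaw_steps.aemeasurable

theorem IsEquilateralIsotropicWalk.variance_selfIntersectionCount {Ω : Type u} [MeasurableSpace Ω]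
    {P : Measure Ω} [IsProbabilityMeasure P] {n : ℕ} {X : Fin (n + 1) → Ω → ℂ}
    (hX : IsEquilateralIsotropicWalk P X) : variance (selfIntersectionCount X) P =
      variance (crossingCount (n := n)) (stepMeasure n) := by
  rw [selfIntersectionCount_eq_comp]
  rw [← hX.hasLaw_steps.map_eq, variance_map _ hX.hasLaw_steps.aemeasurable]
  rw [hX.hasLaw_steps.map_eq]
  exact (memLp_crossingCount n).aemeasurable

theorem IsEquilateralIsotropicWalk.integral_selfIntersectionCount {Ω : Type u} [MeasurableSpace Ω]
    {P : Measure Ω} [IsProbabilityMeasure P] {n : ℕ} {X : Fin (n + 1) → Ω → ℂ}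
    (hX : IsEquilateralIsotropicWalk P X) : ∫ ω, selfIntersectionCount X ω ∂P =
      ∫ ξ, crossingCount ξ ∂stepMeasure n := by
  rw [selfIntersectionCount_eq_comp]
  exact hX.hasLaw_steps.integral_comp (memLp_crossingCount n).aestronglyMeasurable
theorem mainTheorem3 :
    (∃ C : ℝ, ∀ n : ℕ, 2 ≤ n →
      ∀ (Ω : Type u) [MeasurableSpace Ω] (P : Measure Ω) [IsProbabilityMeasure P]
        (X : Fin (n + 1) → Ω → ℂ), IsEquilateralIsotropicWalk P X →
        MemLp (selfIntersectionCount X) 2 P ∧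
        variance (selfIntersectionCount X) P ≤ C * ((n : ℝ) ^ 2 * Real.log n) ∧
        P.real {ω | (n : ℝ) * Real.log n ^ (2 / 3 : ℝ) <
            |selfIntersectionCount X ω - ∫ ω', selfIntersectionCount X ω' ∂P|} ≤
          C / Real.log n ^ (1 / 3 : ℝ)) ∧
    (∀ ε : ℝ, 0 < ε → ∀ δ : ℝ, 0 < δ → ∃ N : ℕ, ∀ n : ℕ, N ≤ n →
      ∀ (Ω : Type u) [MeasurableSpace Ω] (P : Measure Ω) [IsProbabilityMeasure P]
        (X : Fin (n + 1) → Ω → ℂ), IsEquilateralIsotropicWalk P X →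
        P.real {ω | ε * ∫ ω', selfIntersectionCount X ω' ∂P <
            |selfIntersectionCount X ω - ∫ ω', selfIntersectionCount X ω' ∂P|} ≤ δ) := by
 
  have hpi := Real.pi_pos
  set C : ℝ := 48 * (32 * Real.pi ^ 2) ^ 2 with hC
  have hC0 : 0 < C := by positivity
  refine ⟨⟨C, ?_⟩, ?_⟩
  · intro n hn Ω _ P _ X hX
    have hvar : variance (selfIntersectionCount X) P ≤ C * ((n : ℝ) ^ 2 * Real.log n) := by
      rw [hX.variance_selfIntersectionCount]
      exact variance_crossingCount_le_mul_log hn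
    refine ⟨hX.memLp_selfIntersectionCount, hvar, ?_⟩
    have hn' : (2 : ℝ) ≤ n := by exact_mod_cast hn
    have hlog : 0 < Real.log n := Real.log_pos (by linarith)
    refine (chebyshev_measureReal_le hX.memLp_selfIntersectionCount (by positivity)).trans ?_
    rw [div_le_div_iff₀ (by positivity) (by positivity)]
    refine (mul_le_mul_of_nonneg_right hvar (by positivity)).trans (le_of_eq ?_)
    have h1 : (Real.log n ^ (2 / 3 : ℝ)) ^ 2 = Real.log n * Real.log n ^ (1 / 3 : ℝ) := by
      rw [← Real.rpow_natCast, ← Real.rpow_mul hlog.le]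
      nth_rewrite 2 [← Real.rpow_one (Real.log n)]
      rw [← Real.rpow_add hlog]
      norm_num
    rw [mul_pow, h1]
    ring
  · intro ε hε δ hδ
    obtain ⟨c, hc, hlow⟩ := exists_le_integral_crossingCount
    -- Chebyshev leaves `C / (ε² c² log n)`; this `N` makes it at most `δ`.
    refine ⟨max 64 ⌈Real.exp (C / (ε ^ 2 * c ^ 2 * δ))⌉₊, fun n hn Ω _ P _ X hX => ?_⟩
    have hn64 : 64 ≤ n := (le_max_left _ _).trans hn
    have hn' : (64 : ℝ) ≤ n := by exact_mod_cast hn64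
    have hexp : Real.exp (C / (ε ^ 2 * c ^ 2 * δ)) ≤ n :=
      (Nat.le_ceil _).trans (by exact_mod_cast (le_max_right _ _).trans hn)
    have hlogge : C / (ε ^ 2 * c ^ 2 * δ) ≤ Real.log n :=
      (Real.le_log_iff_exp_le (by linarith)).2 hexp
    have hlog : 0 < Real.log n := Real.log_pos (by linarith)
    have hmean : c * (n * Real.log n) ≤ ∫ ω, selfIntersectionCount X ω ∂P := by
      rw [hX.integral_selfIntersectionCount]
      exact hlow n hn64
    have hmean0 : 0 < c * (n * Real.log n) := by positivity
    have hmean1 := hmean0.trans_le hmean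
    have hvar : variance (selfIntersectionCount X) P ≤ C * ((n : ℝ) ^ 2 * Real.log n) := by
      rw [hX.variance_selfIntersectionCount]
      exact variance_crossingCount_le_mul_log (by omega)
    refine (chebyshev_measureReal_le hX.memLp_selfIntersectionCount (by positivity)).trans ?_
    calc variance (selfIntersectionCount X) P / (ε * ∫ ω, selfIntersectionCount X ω ∂P) ^ 2
        ≤ C * ((n : ℝ) ^ 2 * Real.log n) / (ε * (c * (n * Real.log n))) ^ 2 := by gcongr
      _ = C / (ε ^ 2 * c ^ 2) / Real.log n := by field_simp
      _ ≤ δ := by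
        rw [div_le_iff₀ hlog]
        rw [div_le_iff₀ (by positivity)] at hlogge ⊢
        linarith
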